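/- Let $\mathbb{T}$ be the set of isomorphism classes of finite (nonempty) rooted trees. For $t\in\mathbb{T}$ let $|t|$ be its number of vertices and let its depth be the maximal length (number of edges) of a simple path starting at the root. For $s,t\in\mathbb{T}$ and a vertex $v$ of $s$, let $s\cup_v t$ be the rooted tree obtained by joining the root of $t$ to $v$ by a new edge. For an edge $e$ of $t$, removing $e$ leaves two rooted trees: $R_e(t)$, which contains the root of $t$, and the branch $P_e(t)$. Put $$\alpha(t_1,t_2,t_3)=|\{e\in E(t_2)\mid R_e(t_2)=t_3,\ P_e(t_2)=t_1\}|,\qquad \beta(t_1,t_2,t_3)=|\{v\in V(t_3)\mid t_1=t_3\cup_v t_2\}|.$$ The insertion-elimination algebra $\mathfrak{g}$ is the complex Lie algebra with basis $\{d\}\cup\{D_t^+,D_t^-\mid t\in\mathbb{T}\}$ and brackets $$[D_s^+,D_t^+]=\sum_{r\in\mathbb{T}}\bigl(\beta(r,s,t)-\beta(r,t,s)\bigr)D_r^+,\qquad [D_s^-,D_t^-]=\sum_{r\in\mathbb{T}}\bigl(\alpha(t,r,s)-\alpha(s,r,t)\bigr)D_r^-,$$ $$[D_s^-,D_t^+]=\sum_{r\in\mathbb{T}}\alpha(s,t,r)D_r^+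 +\sum_{r\in\mathbb{T}}\beta(s,t,r)D_r^-\quad(s\neq t),\qquad [D_t^-,D_t^+]=d,$$ $$[d,D_t^{+}]=|t|\,D_t^{+},\qquad [d,D_t^-]=-|t|\,D_t^-.$$ Let $\mathfrak{n}^+\subseteq\mathfrak{g}$ be the subalgebra spanned by the $D_t^+$, $t\in\mathbb{T}$. Let $\eta:\mathfrak{n}^+\to\mathbb{C}$ be a nonzero Lie algebra homomorphism that is depth-bounded: there is a positive integer $M$ such that $\eta(D_t^+)=0$ for every $t\in\mathbb{T}$ of depth at least $M$. Let $\mathbb{C}_\eta$ be the one-dimensional $\mathfrak{n}^+$-module on which $x\in\mathfrak{n}^+$ acts by $\eta(x)$, and let $M_\eta=U(\mathfrak{g})\otimes_{U(\mathfrak{n}^+)}\mathbb{C}_\eta$. Then the space of Whittaker vectors of type $\eta$ in $M_\eta$, $\{v\in M_\eta\mid x v=\eta(x)v \text{ for all } x\in\mathfrak{n}^+\}$, is one-dimensional, and $M_\eta$ is a simple $\mathfrak{g}$-module. -/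

import Mathlib

namespace InsertionElimination

/-- Plane (ordered) rooted trees: a root together with the list of its branches. -/
inductive PlaneTree : Type
  | node (branches : List PlaneTree) : PlaneTree

/-- Reordering the branches at one vertex of a plane tree. -/
inductive PlaneTree.Reorder : PlaneTree → PlaneTree → Prop
  | root {l l' : List PlaneTree} (h : l.Perm l') : Reorder (.node l) (.node l')
  | branch (l l' : List PlaneTree) {a b : PlaneTree} (h : Reorder a b) :
      Reorder (.node (l ++ a :: l')) (.node (l ++ b :: l'))

/-- The number of vertices of a plane tree. -/
def PlaneTree.size : PlaneTree → ℕ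
  | .node l => 1 + (l.map PlaneTree.size).sum

theorem PlaneTree.Reorder.size_eq {s t : PlaneTree} (h : PlaneTree.Reorder s t) :
    s.size = t.size := by
  induction h with
  | root h => simp only [PlaneTree.size]; rw [(h.map _).sum_eq]
  | branch l l' h ih => simp [PlaneTree.size, ih]

/-- Isomorphism classes of finite rooted trees (the set `𝕋`): plane trees up to reordering
branches. -/
def RTree : Type := Quot PlaneTree.Reorder

namespace RTree

noncomputable instance : DecidableEq RTree := Classical.decEq _

/-- The isomorphism class of a plane tree. -/
def mk (p : PlaneTree) : RTree := Quot.mk _ p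

theorem mk_eq_of_reorder {p q : PlaneTree} (h : p.Reorder q) : mk p = mk q := Quot.sound h

/-- A plane representative. -/
noncomputable def rep (t : RTree) : PlaneTree := Quot.out t

theorem mk_rep (t : RTree) : mk t.rep = t := Quot.out_eq t

theorem ind_mk {motive : RTree → Prop} (h : ∀ l, motive (mk (.node l))) (t : RTree) :
    motive t := Quot.ind (fun ⟨l⟩ => h l) t

/-- The number of vertices `|t|`. -/
def size (t : RTree) : ℕ := Quot.lift PlaneTree.size (fun _ _ h => h.size_eq) t

/-- The forest of components of `t`: the branches at the root, with multiplicity. -/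
def components (t : RTree) : Multiset RTree :=
  Quot.lift (fun p => match p with | .node l => ((l.map mk : List RTree) : Multiset _))
    (by
      intro a b h
      cases h with
      | root h => exact Multiset.coe_eq_coe.2 (h.map _)
      | branch l l' h => simp only [List.map_append, List.map_cons, mk_eq_of_reorder h]) t

theorem components_mk (l : List PlaneTree) :
    (mk (.node l)).components = ((l.map mk : List RTree) : Multiset RTree) := rfl

/-- The tree `⋃ c` whose forest of components is the given forest `c`. -/
noncomputable def node (c : Multiset RTree) : RTree :=
  Quot.lift (fun l : List RTree => mk (.node (l.map rep)))
    (fun _ _ h => mk_eq_of_reorder (.root (h.map _))) c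

theorem node_coe (l : List RTree) : node l = mk (.node (l.map rep)) := rfl

theorem components_node (c : Multiset RTree) : (node c).components = c := by
  induction c using Quot.inductionOn with
  | h l =>
    change (node (l : Multiset RTree)).components = (l : Multiset RTree)
    rw [node_coe, components_mk, List.map_map]
    congr 1
    conv_rhs => rw [← List.map_id l]
    exact List.map_congr_left fun a _ => mk_rep a

theorem mk_branch_eq (l l' : List PlaneTree) {a b : PlaneTree} (h : mk a = mk b) :
    mk (.node (l ++ a :: l')) = mk (.node (l ++ b :: l')) := by
  replace h := Quot.eqvGen_exact h
  induction h with
  | rel _ _ h => exact mk_eq_of_reorder (.branch l l' h)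
  | refl => rfl
  | symm _ _ _ ih => exact ih.symm
  | trans _ _ _ _ _ ih1 ih2 => exact ih1.trans ih2

theorem node_components (t : RTree) : node t.components = t := by
  induction t using ind_mk with
  | h l =>
    rw [components_mk, node_coe]
    suffices H : ∀ l₁ l₂ : List PlaneTree,
        mk (.node (l₁ ++ (l₂.map mk).map rep)) = mk (.node (l₁ ++ l₂)) from H [] l
    intro l₁ l₂
    induction l₂ generalizing l₁ with
    | nil => rfl
    | cons a l₂ ih =>
      simp only [List.map_cons]
      rw [mk_branch_eq _ _ (mk_rep (mk a))]
      simpa using ih (l₁ ++ [a])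

theorem size_eq (t : RTree) : t.size = 1 + (t.components.map size).sum := by
  induction t using ind_mk with
  | h l =>
    rw [components_mk, Multiset.map_coe, Multiset.sum_coe, List.map_map]
    change PlaneTree.size _ = _
    rw [PlaneTree.size]
    rfl

theorem size_lt_of_mem {x t : RTree} (h : x ∈ t.components) : x.size < t.size := by
  rw [size_eq t]
  have := Multiset.single_le_sum (fun _ _ => Nat.zero_le _) _ (Multiset.mem_map_of_mem size h)
  omega

/-- The depth of `t`: the maximal number of edges of a path descending from the root. -/
noncomputable def depth (t : RTree) : ℕ :=
  (t.components.attach.map fun x => depth x.1 + 1).sup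
termination_by t.size
decreasing_by exact size_lt_of_mem x.2

/-- The multiset of the trees `t ∪_v s`, where `v` runs over the vertices of `t`. Either `v` is
the root of `t`, or `v` is a vertex of one of the components `x` of `t`. -/
noncomputable def grafts (s t : RTree) : Multiset RTree :=
  node (s ::ₘ t.components) ::ₘ t.components.attach.bind fun x =>
    (grafts s x.1).map fun y => node (y ::ₘ t.components.erase x.1)
termination_by t.size
decreasing_by exact size_lt_of_mem x.2

/-- The multiset of the pairs `(P_e(t), R_e(t))`, where `e` runs over the edges of `t`. Either `e`
joins the root of `t` to one of its components `x`, or `e` is an edge of such an `x`. -/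
noncomputable def cuts (t : RTree) : Multiset (RTree × RTree) :=
  t.components.attach.bind fun x =>
    (x.1, node (t.components.erase x.1)) ::ₘ
      (cuts x.1).map fun e => (e.1, node (e.2 ::ₘ t.components.erase x.1))
termination_by t.size
decreasing_by exact size_lt_of_mem x.2

/-- `α(t₁, t₂, t₃)`: the number of edges `e` of `t₂` with `R_e(t₂) = t₃` and `P_e(t₂) = t₁`. -/
noncomputable def alpha (t₁ t₂ t₃ : RTree) : ℕ := t₂.cuts.count (t₁, t₃)

/-- `β(t₁, t₂, t₃)`: the number of vertices `v` of `t₃` with `t₁ = t₃ ∪_v t₂`. -/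
noncomputable def beta (t₁ t₂ t₃ : RTree) : ℕ := (grafts t₂ t₃).count t₁

theorem grafts_node (s : RTree) (c : Multiset RTree) :
    grafts s (node c) = node (s ::ₘ c) ::ₘ c.bind fun x =>
      (grafts s x).map fun y => node (y ::ₘ c.erase x) := by
  rw [grafts, components_node]
  conv_rhs => rw [← Multiset.attach_map_val c]
  rw [Multiset.bind_map]
  simp

theorem cuts_node (c : Multiset RTree) :
    cuts (node c) = c.bind fun x => (x, node (c.erase x)) ::ₘ
      (cuts x).map fun e => (e.1, node (e.2 ::ₘ c.erase x)) := by
  rw [cuts, components_node]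
  conv_rhs => rw [← Multiset.attach_map_val c]
  rw [Multiset.bind_map]
  simp

theorem size_node (c : Multiset RTree) : (node c).size = 1 + (c.map size).sum := by
  rw [size_eq, components_node]

theorem induction_node {motive : RTree → Prop}
    (h : ∀ c : Multiset RTree, (∀ x ∈ c, motive x) → motive (node c)) (t : RTree) :
    motive t := by
  induction hn : t.size using Nat.strong_induction_on generalizing t with
  | _ n ih =>
    rw [← node_components t]
    exact h _ fun x hx => ih x.size (hn ▸ size_lt_of_mem hx) x rfl

theorem mem_grafts_of_mem_cuts {p r t : RTree} (h : (p, r) ∈ t.cuts) : t ∈ grafts p r := by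
  induction t using induction_node generalizing r with
  | h c ih =>
    rw [cuts_node, Multiset.mem_bind] at h
    obtain ⟨x, hx, h⟩ := h
    rw [Multiset.mem_cons, Multiset.mem_map] at h
    rcases h with h | ⟨⟨q, y⟩, hy, h⟩
    · obtain ⟨rfl, rfl⟩ := Prod.mk.inj h
      rw [grafts_node, Multiset.cons_erase hx]
      exact Multiset.mem_cons_self _ _
    · obtain ⟨rfl, rfl⟩ := Prod.mk.inj h
      rw [grafts_node]
      refine Multiset.mem_cons_of_mem (Multiset.mem_bind.2 ⟨y, Multiset.mem_cons_self _ _,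
        Multiset.mem_map.2 ⟨x, ih x hx hy, ?_⟩⟩)
      rw [Multiset.erase_cons_head, Multiset.cons_erase hx]

theorem mem_cuts_of_mem_grafts {p r t : RTree} (h : t ∈ grafts p r) : (p, r) ∈ t.cuts := by
  induction r using induction_node generalizing t with
  | h c ih =>
    rw [grafts_node, Multiset.mem_cons, Multiset.mem_bind] at h
    rcases h with rfl | ⟨x, hx, h⟩
    · rw [cuts_node]
      refine Multiset.mem_bind.2 ⟨p, Multiset.mem_cons_self _ _, ?_⟩
      rw [Multiset.erase_cons_head]
      exact Multiset.mem_cons_self _ _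
    · obtain ⟨y, hy, rfl⟩ := Multiset.mem_map.1 h
      rw [cuts_node]
      refine Multiset.mem_bind.2 ⟨y, Multiset.mem_cons_self _ _, Multiset.mem_cons_of_mem
        (Multiset.mem_map.2 ⟨(p, x), ih x hx hy, ?_⟩)⟩
      rw [Multiset.erase_cons_head, Multiset.cons_erase hx]

theorem finite_beta (s t : RTree) : {r | beta s t r ≠ 0}.Finite := by
  refine (Multiset.finite_toSet (s.cuts.map Prod.snd)).subset fun r hr => ?_
  exact Multiset.mem_map.2
    ⟨(t, r), mem_cuts_of_mem_grafts (Multiset.count_ne_zero.1 hr), rfl⟩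

theorem finite_beta' (s t : RTree) : {r | beta r s t ≠ 0}.Finite :=
  (Multiset.finite_toSet (grafts s t)).subset fun _ hr => Multiset.count_ne_zero.1 hr

theorem finite_alpha (s t : RTree) : {r | alpha s t r ≠ 0}.Finite := by
  refine (Multiset.finite_toSet (t.cuts.map Prod.snd)).subset fun r hr => ?_
  exact Multiset.mem_map.2 ⟨(s, r), Multiset.count_ne_zero.1 hr, rfl⟩

theorem finite_alpha' (s t : RTree) : {r | alpha s r t ≠ 0}.Finite :=
  (Multiset.finite_toSet (grafts s t)).subset fun _ hr =>
    mem_grafts_of_mem_cuts (Multiset.count_ne_zero.1 hr)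

end RTree

open InsertionElimination.RTree

/-- Labels of the basis `{d} ∪ {D_t^+, D_t^- | t ∈ 𝕋}` of the insertion-elimination algebra. -/
inductive Label : Type
  | d : Label
  | plus (t : RTree) : Label
  | minus (t : RTree) : Label

/-- The insertion-elimination algebra `𝔤`: the complex vector space with basis `Label`. Its Lie
bracket is defined below. -/
def InsElimAlgebra : Type := Label →₀ ℂ

namespace InsElimAlgebra

noncomputable instance : AddCommGroup InsElimAlgebra := inferInstanceAs (AddCommGroup (Label →₀ ℂ))
noncomputable instance : Module ℂ InsElimAlgebra := inferInstanceAs (Module ℂ (Label →₀ ℂ))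

/-- The basis of `𝔤`. -/
noncomputable def basis : Module.Basis Label ℂ InsElimAlgebra := ⟨LinearEquiv.refl ℂ (Label →₀ ℂ)⟩

/-- The basis element `d`. -/
noncomputable def d : InsElimAlgebra := basis .d
/-- The basis element `D_t^+`. -/
noncomputable def Dp (t : RTree) : InsElimAlgebra := basis (.plus t)
/-- The basis element `D_t^-`. -/
noncomputable def Dm (t : RTree) : InsElimAlgebra := basis (.minus t)

/-- The bracket of two basis elements, by the defining relations of `𝔤`. In `[D_s^-, D_t^+]` both
sums vanish when `s = t`, so that `[D_t^-, D_t^+] = d`; the summand `d` is absent when `s ≠ t`. -/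
noncomputable def basisBracket : Label → Label → InsElimAlgebra
  | .d, .d => 0
  | .d, .plus t => (t.size : ℂ) • Dp t
  | .d, .minus t => -((t.size : ℂ) • Dm t)
  | .plus t, .d => -((t.size : ℂ) • Dp t)
  | .minus t, .d => (t.size : ℂ) • Dm t
  | .plus s, .plus t => ∑ᶠ r, ((beta r s t : ℂ) - (beta r t s : ℂ)) • Dp r
  | .minus s, .minus t => ∑ᶠ r, ((alpha t r s : ℂ) - (alpha s r t : ℂ)) • Dm r
  | .minus s, .plus t =>
      ∑ᶠ r, (alpha s t r : ℂ) • Dp r + ∑ᶠ r, (beta s t r : ℂ) • Dm r + if s = t then d else 0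
  | .plus t, .minus s =>
      -(∑ᶠ r, (alpha s t r : ℂ) • Dp r + ∑ᶠ r, (beta s t r : ℂ) • Dm r + if s = t then d else 0)

/-- The bracket of `𝔤` as a bilinear map. -/
noncomputable def bracketₗ : InsElimAlgebra →ₗ[ℂ] InsElimAlgebra →ₗ[ℂ] InsElimAlgebra :=
  basis.constr ℂ fun i => basis.constr ℂ fun j => basisBracket i j

theorem bracketₗ_basis (i j : Label) : bracketₗ (basis i) (basis j) = basisBracket i j := by
  simp [bracketₗ]

theorem basisBracket_antisymm (i j : Label) : basisBracket i j = -basisBracket j i := by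
  have h : ∀ (f g : RTree → ℂ) (D : RTree → InsElimAlgebra),
      ∑ᶠ r, (f r - g r) • D r = -∑ᶠ r, (g r - f r) • D r := by
    intro f g D
    rw [← finsum_neg_distrib]
    exact finsum_congr fun r => by rw [← neg_smul, neg_sub]
  rcases i with _ | s | s <;> rcases j with _ | t | t <;> simp only [basisBracket, neg_neg, neg_zero]
  · exact h _ _ _
  · exact h _ _ _

theorem bracketₗ_antisymm (x y : InsElimAlgebra) : bracketₗ x y = -bracketₗ y x := by
  have : bracketₗ = -bracketₗ.flip := by
    refine basis.ext fun i => basis.ext fun j => ?_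
    simp only [LinearMap.neg_apply, LinearMap.flip_apply, bracketₗ_basis]
    exact basisBracket_antisymm i j
  exact congrArg (fun f => f x y) this

/-! The Jacobi identity is checked in a faithful representation on polynomials in variables `X_t`,
the monomials of which are the forests. -/

/-- Polynomials whose monomials are the forests. -/
abbrev Poly : Type := MvPolynomial RTree ℂ

/-- The derivation induced by `D_s^+` on trees. -/
noncomputable def derPlus (s : RTree) : Derivation ℂ Poly Poly :=
  MvPolynomial.mkDerivation ℂ fun r => ((grafts s r).map MvPolynomial.X).sum

/-- The derivation induced by `D_s^-` on trees. -/
noncomputable def derMinus (s : RTree) : Derivation ℂ Poly Poly :=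
  MvPolynomial.mkDerivation ℂ fun r =>
    (r.cuts.map fun e => if e.1 = s then (MvPolynomial.X e.2 : Poly) else 0).sum

/-- The derivation induced by `d` on trees. -/
noncomputable def derDeg : Derivation ℂ Poly Poly :=
  MvPolynomial.mkDerivation ℂ fun r => (r.size : ℂ) • MvPolynomial.X r

/-- The action on trees, as a linear map to derivations. -/
noncomputable def der : InsElimAlgebra →ₗ[ℂ] Derivation ℂ Poly Poly :=
  basis.constr ℂ fun i => match i with
    | .d => derDeg
    | .plus t => derPlus t
    | .minus t => derMinus t

/-- The multiplication part of the action on forests. -/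
noncomputable def pol : InsElimAlgebra →ₗ[ℂ] Poly :=
  basis.constr ℂ fun i => match i with
    | .d => 1
    | .plus t => MvPolynomial.X t
    | .minus _ => 0

/-- The constant coefficient part of the action on forests. -/
noncomputable def pd : InsElimAlgebra →ₗ[ℂ] Derivation ℂ Poly Poly :=
  basis.constr ℂ fun i => match i with
    | .d => 0
    | .plus _ => 0
    | .minus t => MvPolynomial.pderiv t

/-- The total derivation part of the action on forests. -/
noncomputable def tot : InsElimAlgebra →ₗ[ℂ] Derivation ℂ Poly Poly := pd + der

/-- The monomial of a forest. -/
noncomputable def mon (c : Multiset RTree) : Poly := (c.map MvPolynomial.X).prod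

/-- The linear map sending the monomial of a forest `c` to the variable of the tree `⋃ c`. -/
noncomputable def plant : Poly →ₗ[ℂ] Poly :=
  (MvPolynomial.basisMonomials RTree ℂ).constr ℂ fun m =>
    MvPolynomial.X (node (Finsupp.toMultiset m))

theorem mon_eq_monomial (c : Multiset RTree) :
    mon c = MvPolynomial.monomial (Multiset.toFinsupp c) 1 := by
  induction c using Multiset.induction with
  | empty => simp [mon]
  | cons a c ih =>
    rw [mon, Multiset.map_cons, Multiset.prod_cons, ← mon, ih, MvPolynomial.X,
      MvPolynomial.monomial_mul, ← Multiset.singleton_add, map_add, Multiset.toFinsupp_singleton,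
      one_mul]

theorem plant_mon (c : Multiset RTree) : plant (mon c) = MvPolynomial.X (node c) := by
  rw [mon_eq_monomial, plant, (by simp : MvPolynomial.monomial (Multiset.toFinsupp c) (1 : ℂ) =
    MvPolynomial.basisMonomials RTree ℂ (Multiset.toFinsupp c)), Module.Basis.constr_basis]
  simp

theorem poly_ext {M : Type*} [AddCommGroup M] [Module ℂ M] {f g : Poly →ₗ[ℂ] M}
    (h : ∀ c, f (mon c) = g (mon c)) : f = g := by
  refine (MvPolynomial.basisMonomials RTree ℂ).ext fun m => ?_
  have := h (Finsupp.toMultiset m)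
  rw [mon_eq_monomial] at this
  simpa using this

theorem derivation_mon (D : Derivation ℂ Poly Poly) (c : Multiset RTree) :
    D (mon c) = (c.map fun x => D (MvPolynomial.X x) * mon (c.erase x)).sum := by
  induction c using Multiset.induction with
  | empty => simp [mon]
  | cons a c ih =>
    have h1 : mon (a ::ₘ c) = MvPolynomial.X a * mon c := by simp [mon]
    rw [h1, Derivation.leibniz, ih, Multiset.map_cons, Multiset.sum_cons, Multiset.erase_cons_head,
      smul_eq_mul, smul_eq_mul, add_comm, mul_comm (mon c)]
    congr 1
    rw [← Multiset.sum_map_mul_left]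
    refine congrArg _ (Multiset.map_congr rfl fun x hx => ?_)
    rw [Multiset.erase_cons_tail_of_mem hx]
    simp only [mon, Multiset.map_cons, Multiset.prod_cons]
    ring

theorem der_plant_basis (i : Label) (c : Multiset RTree) :
    der (basis i) (plant (mon c)) = plant (pol (basis i) * mon c + tot (basis i) (mon c)) := by
  have hcons : ∀ a c, MvPolynomial.X a * mon c = mon (a ::ₘ c) := fun a c => by simp [mon]
  rw [plant_mon]
  rcases i with _ | t | s
  · simp only [der, pol, tot, pd, Module.Basis.constr_basis, LinearMap.add_apply, zero_add, one_mul,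
      derDeg, MvPolynomial.mkDerivation_X, map_add, plant_mon]
    rw [derivation_mon, size_node, map_multiset_sum, Multiset.map_map]
    have : (c.map (plant ∘ fun x => (MvPolynomial.mkDerivation ℂ
        fun r : RTree => (r.size : ℂ) • (MvPolynomial.X r : Poly)) (MvPolynomial.X x) *
          mon (c.erase x))) = c.map fun x => (x.size : ℂ) • (MvPolynomial.X (node c) : Poly) := by
      refine Multiset.map_congr rfl fun x hx => ?_
      simp only [Function.comp_apply, MvPolynomial.mkDerivation_X]
      rw [smul_mul_assoc, hcons, Multiset.cons_erase hx, map_smul, plant_mon]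
    rw [this, Nat.cast_add, add_smul, Nat.cast_one, one_smul, Nat.cast_multiset_sum,
      Multiset.map_map, Multiset.sum_smul, Multiset.map_map]
    rfl
  · simp only [der, pol, tot, pd, Module.Basis.constr_basis, LinearMap.add_apply, zero_add,
      derPlus, MvPolynomial.mkDerivation_X, map_add, hcons, plant_mon]
    rw [grafts_node, Multiset.map_cons, Multiset.sum_cons, derivation_mon, Multiset.map_bind,
      Multiset.sum_bind, map_multiset_sum, Multiset.map_map]
    congr 2
    refine Multiset.map_congr rfl fun x hx => ?_
    simp only [Function.comp_apply, MvPolynomial.mkDerivation_X]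
    rw [← Multiset.sum_map_mul_right, map_multiset_sum, Multiset.map_map, Multiset.map_map]
    simp only [Function.comp_def, hcons, plant_mon]
  · simp only [der, pol, tot, pd, Module.Basis.constr_basis, LinearMap.add_apply, zero_mul, zero_add,
      derMinus, MvPolynomial.mkDerivation_X]
    rw [cuts_node, derivation_mon, Multiset.map_bind, Multiset.sum_bind,
      map_multiset_sum, Multiset.map_map]
    refine congrArg _ (Multiset.map_congr rfl fun x hx => ?_)
    simp only [Function.comp_apply, MvPolynomial.mkDerivation_X, Multiset.map_cons,
      Multiset.sum_cons, Multiset.map_map, Derivation.add_apply, add_mul, map_add]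
    congr 1
    · rw [MvPolynomial.pderiv_X]
      by_cases h : x = s
      · subst h; simp [plant_mon]
      · rw [if_neg h, Pi.single_eq_of_ne (M := fun _ => Poly) h]; simp
    · rw [← Multiset.sum_map_mul_right, map_multiset_sum, Multiset.map_map]
      refine congrArg _ (Multiset.map_congr rfl fun e _ => ?_)
      simp only [Function.comp_apply]
      split_ifs
      · rw [hcons, plant_mon]
      · simp

theorem induct {motive : InsElimAlgebra → Prop} (hb : ∀ i, motive (basis i)) (h0 : motive 0)
    (ha : ∀ x y, motive x → motive y → motive (x + y))
    (hs : ∀ (c : ℂ) x, motive x → motive (c • x)) (x : InsElimAlgebra) : motive x := by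
  have hx : x ∈ Submodule.span ℂ (Set.range basis) := by
    rw [basis.span_eq]; exact Submodule.mem_top
  induction hx using Submodule.span_induction with
  | mem x h => obtain ⟨i, rfl⟩ := h; exact hb i
  | zero => exact h0
  | add x y _ _ hx hy => exact ha x y hx hy
  | smul c x _ hx => exact hs c x hx

theorem der_plant (x : InsElimAlgebra) (p : Poly) :
    der x (plant p) = plant (pol x * p + tot x p) := by
  induction x using induct with
  | hb i =>
    have : (der (basis i)).toLinearMap ∘ₗ plant =
        plant ∘ₗ (LinearMap.mulLeft ℂ (pol (basis i)) + (tot (basis i)).toLinearMap) :=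
      poly_ext fun c => der_plant_basis i c
    exact LinearMap.congr_fun this p
  | h0 => simp
  | ha x y hx hy =>
    simp only [map_add, Derivation.add_apply, hx, hy, add_mul]
    abel
  | hs c x hx =>
    simp only [map_smul, Derivation.smul_apply, hx, smul_mul_assoc, ← smul_add]



theorem finite_smul {M : Type*} [AddCommGroup M] [Module ℂ M] {c : RTree → ℂ}
    (hc : {r | c r ≠ 0}.Finite) (f : RTree → M) : (Function.support fun r => c r • f r).Finite :=
  hc.subset fun r hr h => hr (by simp [h])

theorem map_sum {M : Type*} [AddCommGroup M] [Module ℂ M] {c : RTree → ℂ}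
    (hc : {r | c r ≠ 0}.Finite) (φ : InsElimAlgebra →ₗ[ℂ] M) (D : RTree → InsElimAlgebra) :
    φ (∑ᶠ r, c r • D r) = ∑ᶠ r, c r • φ (D r) := by
  rw [map_finsum φ (finite_smul hc D)]
  simp

theorem finsum_count {M : Type*} [AddCommGroup M] [Module ℂ M] (m : Multiset RTree)
    (f : RTree → M) : ∑ᶠ r, (m.count r : ℂ) • f r = (m.map f).sum := by
  rw [Finset.sum_multiset_map_count, finsum_eq_sum_of_support_subset (s := m.toFinset)]
  · exact Finset.sum_congr rfl fun r _ => Nat.cast_smul_eq_nsmul ℂ _ _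
  · intro r hr
    rw [Finset.mem_coe, Multiset.mem_toFinset]
    by_contra h
    exact hr (by simp [Multiset.count_eq_zero_of_notMem h])

theorem cast_finite {c : RTree → ℕ} (h : {r | c r ≠ 0}.Finite) :
    {r | (c r : ℂ) ≠ 0}.Finite := h.subset fun r hr h => hr (by simp [h])

theorem cast_sub_finite {c e : RTree → ℕ} (h : {r | c r ≠ 0}.Finite) (h' : {r | e r ≠ 0}.Finite) :
    {r | ((c r : ℂ) - (e r : ℂ)) ≠ 0}.Finite :=
  (h.union h').subset fun r hr => by
    by_contra hn
    simp only [Set.mem_union, Set.mem_ofPred_eq, not_or, not_not] at hn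
    exact hr (by simp [hn.1, hn.2])

theorem pol_d : pol d = 1 := by simp [pol, d]
theorem pol_Dp (t : RTree) : pol (Dp t) = MvPolynomial.X t := by simp [pol, Dp]
theorem pol_Dm (t : RTree) : pol (Dm t) = 0 := by simp [pol, Dm]
theorem pd_d : pd d = 0 := by simp [pd, d]
theorem pd_Dp (t : RTree) : pd (Dp t) = 0 := by simp [pd, Dp]
theorem pd_Dm (t : RTree) : pd (Dm t) = MvPolynomial.pderiv t := by simp [pd, Dm]
theorem der_d : der d = derDeg := by simp [der, d]
theorem der_Dp (t : RTree) : der (Dp t) = derPlus t := by simp [der, Dp]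
theorem der_Dm (t : RTree) : der (Dm t) = derMinus t := by simp [der, Dm]

/-- `pd x` sends the variable `X_u` to the coefficient of `D_u^-` in `x`. -/
theorem pd_X (x : InsElimAlgebra) (u : RTree) :
    pd x (MvPolynomial.X u) = MvPolynomial.C (basis.repr x (.minus u)) := by
  induction x using induct with
  | hb i =>
    rcases i with _ | t | t
    · change pd d _ = _; simp [pd_d]
    · change pd (Dp t) _ = _; simp [pd_Dp]
    · change pd (Dm t) _ = _
      rw [pd_Dm, MvPolynomial.pderiv_X]
      by_cases h : u = t
      · subst h; simp
      · rw [Pi.single_eq_of_ne (M := fun _ => Poly) h]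
        simp [Ne.symm h]
  | h0 => simp
  | ha x y hx hy => simp [hx, hy]
  | hs c x hx => simp [hx, MvPolynomial.smul_eq_C_mul]

theorem pd_sum_Dp {c : RTree → ℂ} (hc : {r | c r ≠ 0}.Finite) : pd (∑ᶠ r, c r • Dp r) = 0 := by
  rw [map_sum hc]; simp [pd_Dp]

theorem pol_sum_Dm {c : RTree → ℂ} (hc : {r | c r ≠ 0}.Finite) : pol (∑ᶠ r, c r • Dm r) = 0 := by
  rw [map_sum hc]; simp [pol_Dm]

theorem pd_sum_Dm {c : RTree → ℂ} (hc : {r | c r ≠ 0}.Finite) (u : RTree) :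
    pd (∑ᶠ r, c r • Dm r) (MvPolynomial.X u) = MvPolynomial.C (c u) := by
  rw [pd_X]
  have := map_sum hc (Finsupp.lapply (Label.minus u) ∘ₗ basis.repr.toLinearMap) Dm
  simp only [LinearMap.comp_apply, Finsupp.lapply_apply, LinearEquiv.coe_coe, Dm,
    Module.Basis.repr_self] at this
  rw [show (∑ᶠ r, c r • Dm r) = ∑ᶠ r, c r • basis (Label.minus r) from rfl, this,
    finsum_eq_single _ u]
  · simp
  · intro r hr
    simp [hr]

theorem derPlus_X (s t : RTree) : derPlus s (MvPolynomial.X t) =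
    ∑ᶠ r, (beta r s t : ℂ) • (MvPolynomial.X r : Poly) := by
  rw [derPlus, MvPolynomial.mkDerivation_X]
  exact (finsum_count _ _).symm

theorem derMinus_X (s t : RTree) : derMinus s (MvPolynomial.X t) =
    ∑ᶠ r, (alpha s t r : ℂ) • (MvPolynomial.X r : Poly) := by
  rw [derMinus, MvPolynomial.mkDerivation_X]
  have h : ∀ r, alpha s t r = ((t.cuts.filter fun e => e.1 = s).map Prod.snd).count r := by
    intro r
    rw [Multiset.count_map, Multiset.filter_filter, alpha, Multiset.count, Multiset.countP_eq_card_filter]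
    congr 1
    refine Multiset.filter_congr fun e _ => ?_
    constructor
    · rintro rfl; exact ⟨rfl, rfl⟩
    · rintro ⟨rfl, rfl⟩; rfl
  simp only [h]
  rw [finsum_count, Multiset.map_map]
  induction t.cuts using Multiset.induction with
  | empty => simp
  | cons e m ih =>
    by_cases he : e.1 = s
    · simp [he, ih]
    · simp [he, ih]

theorem pderiv_derPlus_X (s t u : RTree) :
    MvPolynomial.pderiv s (derPlus t (MvPolynomial.X u)) = MvPolynomial.C (beta s t u : ℂ) := by
  rw [derPlus_X, map_finsum (MvPolynomial.pderiv s) (finite_smul (cast_finite (finite_beta' t u))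
    (fun r => (MvPolynomial.X r : Poly))),
    finsum_eq_single _ s]
  · simp [MvPolynomial.smul_eq_C_mul]
  · intro r hr
    rw [Derivation.map_smul, MvPolynomial.pderiv_X_of_ne hr, smul_zero]

theorem pderiv_derMinus_X (s t u : RTree) :
    MvPolynomial.pderiv s (derMinus t (MvPolynomial.X u)) = MvPolynomial.C (alpha t u s : ℂ) := by
  rw [derMinus_X, map_finsum (MvPolynomial.pderiv s) (finite_smul (cast_finite (finite_alpha t u))
    (fun r => (MvPolynomial.X r : Poly))),
    finsum_eq_single _ s]
  · simp [MvPolynomial.smul_eq_C_mul]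
  · intro r hr
    rw [Derivation.map_smul, MvPolynomial.pderiv_X_of_ne hr, smul_zero]

theorem map_pderiv_X (D : Derivation ℂ Poly Poly) (s u : RTree) :
    D (MvPolynomial.pderiv s (MvPolynomial.X u)) = 0 := by
  by_cases h : u = s
  · subst h; simp
  · rw [MvPolynomial.pderiv_X_of_ne h, map_zero]

theorem pol_plus_plus (s t : RTree) : pol (basisBracket (.plus s) (.plus t)) =
    derPlus s (MvPolynomial.X t) - derPlus t (MvPolynomial.X s) := by
  rw [basisBracket, map_sum (cast_sub_finite (finite_beta' _ _) (finite_beta' _ _)), derPlus_X,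
    derPlus_X, ← finsum_sub_distrib (finite_smul (cast_finite (finite_beta' s t)) _)
      (finite_smul (cast_finite (finite_beta' t s)) _)]
  exact finsum_congr fun r => by rw [pol_Dp, sub_smul]

theorem pol_minus_plus (s t : RTree) : pol (basisBracket (.minus s) (.plus t)) =
    derMinus s (MvPolynomial.X t) + MvPolynomial.pderiv s (MvPolynomial.X t) := by
  rw [basisBracket, map_add, map_add, map_sum (cast_finite (finite_alpha _ _)),
    pol_sum_Dm (cast_finite (finite_beta _ _)), derMinus_X, add_zero]
  congr 1
  · exact finsum_congr fun r => by rw [pol_Dp]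
  · by_cases h : s = t
    · subst h; simp [pol_d]
    · rw [if_neg h, MvPolynomial.pderiv_X_of_ne (Ne.symm h), map_zero]

/-- The two bracket identities, for basis elements. -/
theorem pol_bracket_basis (i j : Label) : pol (bracketₗ (basis i) (basis j)) =
    tot (basis i) (pol (basis j)) - tot (basis j) (pol (basis i)) := by
  have hd : basis .d = d := rfl
  have hp : ∀ t, basis (.plus t) = Dp t := fun _ => rfl
  have hm : ∀ t, basis (.minus t) = Dm t := fun _ => rfl
  rw [bracketₗ_basis]
  rcases i with _ | s | s <;> rcases j with _ | t | t
  · simp [basisBracket]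
  · simp [basisBracket, tot, hd, hp, pol_d, pol_Dp, pd_d, pd_Dp, der_d, derDeg]
  · simp [basisBracket, tot, hd, hm, pol_d, pol_Dm]
  · simp [basisBracket, tot, hd, hp, pol_d, pol_Dp, pd_d, pd_Dp, der_d, derDeg]
  · rw [pol_plus_plus]
    simp [tot, hp, pol_Dp, pd_Dp, der_Dp]
  · rw [basisBracket_antisymm, map_neg, pol_minus_plus]
    simp [tot, hp, hm, pol_Dp, pol_Dm, pd_Dm, der_Dm, add_comm]
  · simp [basisBracket, tot, hd, hm, pol_d, pol_Dm]
  · rw [pol_minus_plus]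
    simp [tot, hp, hm, pol_Dp, pol_Dm, pd_Dm, der_Dm, add_comm]
  · rw [basisBracket, pol_sum_Dm (cast_sub_finite (finite_alpha' _ _) (finite_alpha' _ _))]
    simp [hm, pol_Dm]

theorem pd_minus_plus (s t : RTree) (u : RTree) :
    pd (basisBracket (.minus s) (.plus t)) (MvPolynomial.X u) =
      MvPolynomial.C (beta s t u : ℂ) := by
  have : pd (if s = t then d else 0) = 0 := by split_ifs <;> simp [pd_d]
  rw [basisBracket, map_add, map_add, pd_sum_Dp (cast_finite (finite_alpha _ _)), this, zero_add,
    add_zero, pd_sum_Dm (cast_finite (finite_beta _ _))]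

theorem pd_bracket_basis (i j : Label) : pd (bracketₗ (basis i) (basis j)) =
    ⁅tot (basis i), tot (basis j)⁆ - ⁅der (basis i), der (basis j)⁆ := by
  have hd : basis .d = d := rfl
  have hp : ∀ t, basis (.plus t) = Dp t := fun _ => rfl
  have hm : ∀ t, basis (.minus t) = Dm t := fun _ => rfl
  have hdm : ∀ t u, MvPolynomial.pderiv t (derDeg (MvPolynomial.X u)) =
      (t.size : ℂ) • (MvPolynomial.pderiv t (MvPolynomial.X u) : Poly) := by
    intro t u
    rw [derDeg, MvPolynomial.mkDerivation_X, Derivation.map_smul]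
    by_cases h : u = t
    · subst h; rfl
    · rw [MvPolynomial.pderiv_X_of_ne h, smul_zero, smul_zero]
  rw [bracketₗ_basis]
  refine MvPolynomial.derivation_ext fun u => ?_
  rcases i with _ | s | s <;> rcases j with _ | t | t
  · simp [basisBracket]
  · simp [basisBracket, tot, hd, hp, pd_d, pd_Dp]
  · simp [basisBracket, tot, hd, hm, pd_d, pd_Dm, Derivation.commutator_apply, der_d, hdm, map_pderiv_X,
      -MvPolynomial.pderiv_X]
  · simp [basisBracket, tot, hd, hp, pd_d, pd_Dp]
  · rw [basisBracket, pd_sum_Dp (cast_sub_finite (finite_beta' _ _) (finite_beta' _ _))]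
    simp [tot, hp, pd_Dp]
  · rw [basisBracket_antisymm, map_neg, Derivation.neg_apply, pd_minus_plus]
    simp [tot, hp, hm, pd_Dp, pd_Dm, Derivation.commutator_apply, der_Dp,
      map_pderiv_X, pderiv_derPlus_X,
      -MvPolynomial.pderiv_X]
  · simp [basisBracket, tot, hd, hm, pd_d, pd_Dm, Derivation.commutator_apply, der_d, hdm, map_pderiv_X,
      -MvPolynomial.pderiv_X]
  · rw [pd_minus_plus]
    simp [tot, hp, hm, pd_Dp, pd_Dm, Derivation.commutator_apply, der_Dp,
      map_pderiv_X, pderiv_derPlus_X,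
      -MvPolynomial.pderiv_X]
  · rw [basisBracket, pd_sum_Dm (cast_sub_finite (finite_alpha' _ _) (finite_alpha' _ _))]
    simp [tot, hm, pd_Dm, Derivation.commutator_apply, der_Dm,
      map_pderiv_X, pderiv_derMinus_X,
      -MvPolynomial.pderiv_X]
    abel

theorem pol_bracket (x y : InsElimAlgebra) :
    pol (bracketₗ x y) = tot x (pol y) - tot y (pol x) := by
  induction x using induct with
  | h0 => simp
  | ha x x' hx hx' => simp only [map_add, LinearMap.add_apply, hx, hx', Derivation.add_apply]; abel
  | hs c x hx =>
    simp only [map_smul, LinearMap.smul_apply, hx, Derivation.smul_apply, smul_sub,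
      Derivation.map_smul]
  | hb i =>
    induction y using induct with
    | h0 => simp
    | ha x x' hx hx' => simp only [map_add, hx, hx', Derivation.add_apply]; abel
    | hs c x hx => simp only [map_smul, hx, Derivation.smul_apply, smul_sub, Derivation.map_smul]
    | hb j => exact pol_bracket_basis i j

theorem pd_bracket (x y : InsElimAlgebra) (p : Poly) :
    pd (bracketₗ x y) p =
      tot x (tot y p) - tot y (tot x p) - (der x (der y p) - der y (der x p)) := by
  induction x using induct with
  | h0 => simp
  | ha x x' hx hx' => simp only [map_add, LinearMap.add_apply, hx, hx', Derivation.add_apply]; abel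
  | hs c x hx =>
    simp only [map_smul, LinearMap.smul_apply, hx, Derivation.smul_apply, smul_sub,
      Derivation.map_smul]
  | hb i =>
    induction y using induct with
    | h0 => simp
    | ha x x' hx hx' => simp only [map_add, hx, hx', Derivation.add_apply]; abel
    | hs c x hx => simp only [map_smul, hx, Derivation.smul_apply, smul_sub, Derivation.map_smul]
    | hb j => rw [pd_bracket_basis]; rfl

theorem der_bracket (x y : InsElimAlgebra) (p : Poly) :
    der (bracketₗ x y) p = der x (der y p) - der y (der x p) := by
  suffices H : der (bracketₗ x y) = ⁅der x, der y⁆ by rw [H, Derivation.commutator_apply]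
  refine MvPolynomial.derivation_ext fun u => ?_
  induction u using induction_node with
  | h c ih =>
    have hc : der (bracketₗ x y) (mon c) = ⁅der x, der y⁆ (mon c) := by
      rw [derivation_mon, derivation_mon]
      exact congrArg _ (Multiset.map_congr rfl fun u hu => by rw [ih u hu])
    have ht : tot (bracketₗ x y) (mon c) = tot x (tot y (mon c)) - tot y (tot x (mon c)) := by
      rw [Derivation.commutator_apply] at hc
      rw [tot, LinearMap.add_apply, Derivation.add_apply, hc, pd_bracket, sub_add_cancel]
      rfl
    rw [← plant_mon, der_plant, ht, pol_bracket, Derivation.commutator_apply, der_plant x,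
      der_plant y, der_plant, der_plant, ← map_sub]
    congr 1
    simp only [map_add, Derivation.leibniz, smul_eq_mul]
    ring

theorem tot_bracket (x y : InsElimAlgebra) (p : Poly) :
    tot (bracketₗ x y) p = tot x (tot y p) - tot y (tot x p) := by
  conv_lhs => rw [tot, LinearMap.add_apply, Derivation.add_apply, der_bracket, pd_bracket,
    sub_add_cancel]

theorem constantCoeff_der_X (x : InsElimAlgebra) (u : RTree) :
    MvPolynomial.constantCoeff (der x (MvPolynomial.X u)) = 0 := by
  induction x using induct with
  | h0 => simp
  | ha x y hx hy => simp [hx, hy]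
  | hs c x hx => simp [hx, MvPolynomial.smul_eq_C_mul]
  | hb i =>
    rcases i with _ | t | t
    · change MvPolynomial.constantCoeff (der d _) = 0
      simp [der_d, derDeg, MvPolynomial.smul_eq_C_mul]
    · change MvPolynomial.constantCoeff (der (Dp t) _) = 0
      simp [der_Dp, derPlus, map_multiset_sum]
    · change MvPolynomial.constantCoeff (der (Dm t) _) = 0
      simp [der_Dm, derMinus, map_multiset_sum, apply_ite]

theorem eq_zero_of_pol_tot {x : InsElimAlgebra} (hp : pol x = 0) (ht : tot x = 0) : x = 0 := by
  have h1 : ∀ x : InsElimAlgebra, MvPolynomial.coeff 0 (pol x) = basis.repr x .d := by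
    intro x
    induction x using induct with
    | h0 => simp
    | ha x y hx hy => simp [hx, hy]
    | hs c x hx => simp [hx]
    | hb i => rcases i with _ | t | t <;> simp [pol]
  have h2 : ∀ (x : InsElimAlgebra) u,
      MvPolynomial.coeff (Finsupp.single u 1) (pol x) = basis.repr x (.plus u) := by
    intro x u
    induction x using induct with
    | h0 => simp
    | ha x y hx hy => simp [hx, hy]
    | hs c x hx => simp [hx]
    | hb i =>
      rcases i with _ | t | t
      · simp [pol, MvPolynomial.coeff_one, eq_comm (a := (0 : RTree →₀ ℕ))]
      · by_cases h : t = u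
        · subst h; simp [pol]
        · have h' : ¬ Finsupp.single t 1 = Finsupp.single u 1 := fun e =>
            h ((Finsupp.single_left_inj one_ne_zero).1 e)
          simp [pol, MvPolynomial.coeff_X, h, h']
      · simp [pol]
  have h3 : ∀ u, basis.repr x (.minus u) = 0 := by
    intro u
    have h := congrArg (fun D => MvPolynomial.constantCoeff (D (MvPolynomial.X u))) ht
    simpa [tot, pd_X, constantCoeff_der_X] using h
  refine basis.repr.map_eq_zero_iff.1 (Finsupp.ext fun i => ?_)
  rcases i with _ | t | t
  · rw [← h1, hp]; simp
  · rw [← h2, hp]; simp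
  · exact h3 t

theorem bracketₗ_jacobi (x y z : InsElimAlgebra) :
    bracketₗ x (bracketₗ y z) = bracketₗ (bracketₗ x y) z + bracketₗ y (bracketₗ x z) := by
  rw [← sub_eq_zero]
  apply eq_zero_of_pol_tot
  · simp only [map_sub, map_add, pol_bracket, tot_bracket]
    abel
  · ext p : 1
    simp only [map_sub, map_add, Derivation.sub_apply, Derivation.add_apply, tot_bracket,
      Derivation.zero_apply]
    abel

theorem bracketₗ_self (x : InsElimAlgebra) : bracketₗ x x = 0 := by
  have h : (2 : ℂ) • bracketₗ x x = 0 := by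
    rw [two_smul]; nth_rewrite 1 [bracketₗ_antisymm]; exact neg_add_cancel _
  exact (smul_eq_zero.1 h).resolve_left two_ne_zero

noncomputable instance : LieRing InsElimAlgebra where
  bracket x y := bracketₗ x y
  add_lie x y z := by change bracketₗ (x + y) z = bracketₗ x z + bracketₗ y z; simp
  lie_add x y z := map_add (bracketₗ x) y z
  lie_self := bracketₗ_self
  leibniz_lie := bracketₗ_jacobi

noncomputable instance : LieAlgebra ℂ InsElimAlgebra where
  lie_smul c x y := map_smul (bracketₗ x) c y

theorem lie_basis (i j : Label) : ⁅basis i, basis j⁆ = basisBracket i j := bracketₗ_basis i j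

theorem lie_Dp_Dp_mem (s t : RTree) : ⁅Dp s, Dp t⁆ ∈ Submodule.span ℂ (Set.range Dp) := by
  change ⁅basis _, basis _⁆ ∈ _
  rw [lie_basis, basisBracket]
  exact finsum_induction (· ∈ Submodule.span ℂ (Set.range Dp)) (zero_mem _)
    (fun _ _ hx hy => add_mem hx hy)
    fun r => Submodule.smul_mem _ _ (Submodule.subset_span (Set.mem_range_self r))

/-- The subalgebra `𝔫⁺` of `𝔤` spanned by the elements `D_t^+`. -/
noncomputable def nPlus : LieSubalgebra ℂ InsElimAlgebra where
  __ := Submodule.span ℂ (Set.range Dp)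
  lie_mem' {x y} hx hy := by
    change ⁅x, y⁆ ∈ Submodule.span ℂ (Set.range Dp)
    induction hx, hy using Submodule.span_induction₂ with
    | mem_mem x y hx hy =>
      obtain ⟨s, rfl⟩ := hx
      obtain ⟨t, rfl⟩ := hy
      exact lie_Dp_Dp_mem s t
    | zero_left y hy => simp
    | zero_right x hx => simp
    | add_left x y z _ _ _ h1 h2 => rw [add_lie]; exact add_mem h1 h2
    | add_right x y z _ _ _ h1 h2 => rw [lie_add]; exact add_mem h1 h2
    | smul_left r x y _ _ h => rw [smul_lie]; exact Submodule.smul_mem _ _ h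
    | smul_right r x y _ _ h => rw [lie_smul]; exact Submodule.smul_mem _ _ h

/-- `D_t^+` as an element of `𝔫⁺`. -/
noncomputable def nPlus.Dp (t : RTree) : nPlus :=
  ⟨InsElimAlgebra.Dp t, Submodule.subset_span ⟨t, rfl⟩⟩

end InsElimAlgebra

open InsertionElimination.InsElimAlgebra
open scoped TensorProduct

attribute [local instance 100] LieRing.ofAssociativeRing

/-- A Lie algebra homomorphism `η : 𝔫⁺ → ℂ` is depth-bounded if there is a positive integer `M`
such that `η (D_t^+) = 0` whenever the depth of `t` is at least `M`. -/
def DepthBounded (η : LieAlgebra.LieCharacter ℂ nPlus) : Prop :=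
  ∃ M : ℕ, 0 < M ∧ ∀ t : RTree, M ≤ t.depth → η (nPlus.Dp t) = 0

/-- The universal enveloping algebra `U(𝔤)`. Left `U(𝔤)`-modules are the `𝔤`-modules. -/
abbrev Ug : Type := UniversalEnvelopingAlgebra ℂ InsElimAlgebra

/-- The universal enveloping algebra `U(𝔫⁺)`. -/
abbrev UnPlus : Type := UniversalEnvelopingAlgebra ℂ nPlus

/-- The algebra homomorphism `U(𝔫⁺) → U(𝔤)` induced by the inclusion `𝔫⁺ ⊆ 𝔤`. -/
noncomputable def UnPlus.incl : UnPlus →ₐ[ℂ] Ug :=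
  UniversalEnvelopingAlgebra.lift ℂ ((UniversalEnvelopingAlgebra.ι ℂ).comp nPlus.incl)

/-- The algebra homomorphism `U(𝔫⁺) → ℂ` extending `η`: an element `b` of `U(𝔫⁺)` acts on the
one-dimensional module `ℂ_η` as multiplication by `UnPlus.char η b`. -/
noncomputable def UnPlus.char (η : LieAlgebra.LieCharacter ℂ nPlus) : UnPlus →ₐ[ℂ] ℂ :=
  UniversalEnvelopingAlgebra.lift ℂ η

/-- The `U(𝔤)`-submodule of `U(𝔤) ⊗_ℂ ℂ_η` generated by the elements `a b ⊗ z - a ⊗ b z` for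
`a` in `U(𝔤)`, `b` in `U(𝔫⁺)` and `z` in `ℂ_η`. -/
noncomputable def balancing (η : LieAlgebra.LieCharacter ℂ nPlus) : Submodule Ug (Ug ⊗[ℂ] ℂ) :=
  Submodule.span Ug {x | ∃ (a : Ug) (b : UnPlus) (z : ℂ),
    x = (a * UnPlus.incl b) ⊗ₜ[ℂ] z - a ⊗ₜ[ℂ] (UnPlus.char η b * z)}

/-- The standard Whittaker module `M_η = U(𝔤) ⊗_{U(𝔫⁺)} ℂ_η`, as a left `U(𝔤)`-module: the
tensor product over the noncommutative ring `U(𝔫⁺)` is the quotient of the tensor product over `ℂ`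
by the balancing relations. -/
abbrev StandardWhittaker (η : LieAlgebra.LieCharacter ℂ nPlus) : Type := (Ug ⊗[ℂ] ℂ) ⧸ balancing η

/-- The space of Whittaker vectors of type `η` in a `𝔤`-module `V`: the vectors `v` such that
`x v = η(x) v` for all `x` in `𝔫⁺`. -/
def whittakerVectors (η : LieAlgebra.LieCharacter ℂ nPlus) (V : Type*) [AddCommGroup V] [Module ℂ V] [Module Ug V]
    [IsScalarTower ℂ Ug V] : Submodule ℂ V where
  carrier := {v | ∀ x : nPlus,
    UniversalEnvelopingAlgebra.ι ℂ (x : InsElimAlgebra) • v = η x • v}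
  zero_mem' x := by simp
  add_mem' {v w} hv hw x := by rw [smul_add, smul_add, hv x, hw x]
  smul_mem' c v hv x := by
    have : SMulCommClass Ug ℂ V := IsScalarTower.to_smulCommClass'
    rw [smul_comm, hv x, smul_comm]

end InsertionElimination

namespace InsertionElimination

open InsertionElimination.RTree InsertionElimination.InsElimAlgebra
open MvPolynomial (X C monomial pderiv IsHomogeneous)
open scoped TensorProduct

attribute [local instance 100] LieRing.ofAssociativeRing

/-! Write `w` for the cyclic vector and `e t` for `η` at `D_t^+`. Three facts give the result: `w`
is nonzero, every nonzero submodule contains a nonzero Whittaker vector, and every Whittaker vector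
is a multiple of `w`.

Nonvanishing is proved without a PBW theorem (`cyclicVector_ne_zero`). The algebra acts on
polynomials in variables `X_t`, where `D_t^+` has leading part multiplication by `X_t`. Exactness of
the Koszul complex in degree one, together with the vanishing of `η` on brackets, shows that `1` is
not a combination of elements `(D_t^+ + e t) p`. A linear functional separating `1` from these is a
Whittaker vector in the contragredient module, and `w` can be mapped to it.

The module is spanned by words in `d` and the `D_t^-` applied to `w`. Each operator `D_s^+ - e s`
strictly lowers the pair (number of letters, total size), ordered lexicographically, so descent
inside a submodule ends at a Whittaker vector (`exists_whittaker`).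

Uniqueness is split according to the sizes of the trees on which `e` is nonzero. If these sizes are
unbounded, consider leading terms by number of letters: for `s` at least as large as every tree
present, `D_s^+ - e s` replaces each `D_s^-` in turn by `-d`, hence acts as `-∂/∂X_s`. So the
leading term of a Whittaker vector is a multiple of a power of `d`; large `s` with `e s ≠ 0` then
exclude every positive power (`eq_smul_of_unbounded`).

If the sizes have a maximum `R`, expand a Whittaker vector in terms `D_c^- d^p w` with `c` a forest
of total size at most `N + 1`. Applying `D_s^+` with `|s| = N + 1 + R` isolates the terms of size `N
+ 1` and pairs them with `e` through edge cuts of `s`. Leading terms turn this pairing into a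
product in a power series ring, which is a domain, so for a suitable `s` the result is nonzero
unless the layer is absent (`exists_sum_trim_ne_zero`). By induction only a polynomial in `d`
remains, and it must be constant (`eq_smul_of_bounded`). -/

theorem RTree.size_pos (t : RTree) : 0 < t.size := by
  rw [RTree.size_eq]; omega

theorem RTree.size_of_mem_grafts {s t r : RTree} (h : r ∈ grafts s t) :
    r.size = s.size + t.size := by
  induction t using induction_node generalizing r with
  | h c ih =>
    rw [grafts_node, Multiset.mem_cons, Multiset.mem_bind] at h
    rcases h with rfl | ⟨x, hx, h⟩
    · simp only [size_node, Multiset.map_cons, Multiset.sum_cons]; omega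
    · obtain ⟨y, hy, rfl⟩ := Multiset.mem_map.1 h
      have h1 := ih x hx hy
      have h2 : (c.map size).sum = x.size + ((c.erase x).map size).sum := by
        rw [← Multiset.sum_cons, ← Multiset.map_cons, Multiset.cons_erase hx]
      simp only [size_node, Multiset.map_cons, Multiset.sum_cons]
      omega

theorem size_of_beta_ne_zero {r s t : RTree} (h : beta r s t ≠ 0) : r.size = s.size + t.size :=
  size_of_mem_grafts (Multiset.count_ne_zero.1 h)

theorem size_of_alpha_ne_zero {s t r : RTree} (h : alpha s t r ≠ 0) : t.size = s.size + r.size :=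
  size_of_mem_grafts (mem_grafts_of_mem_cuts (Multiset.count_ne_zero.1 h))

/-! ### Homogeneous forest polynomials and Koszul exactness -/

theorem mon_cons (t : RTree) (c : Multiset RTree) : mon (t ::ₘ c) = X t * mon c := by
  simp [mon]

theorem mon_zero : mon 0 = 1 := by simp [mon]

theorem isHomogeneous_mon (c : Multiset RTree) : (mon c).IsHomogeneous (Multiset.card c) := by
  induction c using Multiset.induction with
  | empty => rw [mon_zero]; exact MvPolynomial.isHomogeneous_one _ _
  | cons a c ih =>
    rw [mon_cons, Multiset.card_cons, add_comm]
    exact (MvPolynomial.isHomogeneous_X _ _).mul ih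

theorem monomial_eq_smul_mon (m : RTree →₀ ℕ) (a : ℂ) :
    (monomial m a : Poly) = a • mon (Finsupp.toMultiset m) := by
  rw [mon_eq_monomial, MvPolynomial.smul_monomial]
  simp

theorem card_toMultiset_eq_degree (m : RTree →₀ ℕ) :
    Multiset.card (Finsupp.toMultiset m) = m.degree := by
  rw [Finsupp.card_toMultiset, Finsupp.degree_apply]; rfl

/-- Induction on homogeneous polynomials. -/
theorem homogeneous_induction {n : ℕ} {motive : Poly → Prop}
    (hm : ∀ c : Multiset RTree, Multiset.card c = n → motive (mon c)) (h0 : motive 0)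
    (ha : ∀ p q, motive p → motive q → motive (p + q))
    (hs : ∀ (a : ℂ) p, motive p → motive (a • p)) {p : Poly} (hp : p.IsHomogeneous n) :
    motive p := by
  rw [← p.support_sum_monomial_coeff]
  refine Finset.sum_induction _ motive ha h0 fun m hm' => ?_
  rw [monomial_eq_smul_mon]
  refine hs _ _ (hm _ ?_)
  rw [card_toMultiset_eq_degree]
  have := hp (MvPolynomial.mem_support_iff.1 hm')
  rwa [Finsupp.degree_eq_weight_one]

theorem isHomogeneous_derivation {D : Derivation ℂ Poly Poly}
    (hD : ∀ t, (D (X t)).IsHomogeneous 1) {n : ℕ} {p : Poly} (hp : p.IsHomogeneous n) :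
    (D p).IsHomogeneous n := by
  refine homogeneous_induction (n := n) (motive := fun p => (D p).IsHomogeneous n)
    (fun c hc => ?_) ?_ ?_ ?_ hp
  · rw [derivation_mon]
    refine Multiset.sum_induction (fun q : Poly => q.IsHomogeneous n) _ (fun _ _ => .add)
      (MvPolynomial.isHomogeneous_zero _ _ _) fun q hq => ?_
    obtain ⟨x, hx, rfl⟩ := Multiset.mem_map.1 hq
    have := (hD x).mul (isHomogeneous_mon (c.erase x))
    rwa [Multiset.card_erase_of_mem hx, add_comm, Nat.pred_eq_sub_one, hc,
      Nat.sub_add_cancel (hc ▸ Multiset.card_pos_iff_exists_mem.2 ⟨x, hx⟩)] at this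
  · rw [map_zero]; exact MvPolynomial.isHomogeneous_zero _ _ _
  · intro p q hp hq; rw [map_add]; exact hp.add hq
  · intro a p hp; rw [Derivation.map_smul]; exact (MvPolynomial.homogeneousSubmodule _ _ n).smul_mem a hp

theorem isHomogeneous_derPlus (s : RTree) {n : ℕ} {p : Poly} (hp : p.IsHomogeneous n) :
    (derPlus s p).IsHomogeneous n := by
  refine isHomogeneous_derivation (fun t => ?_) hp
  rw [derPlus, MvPolynomial.mkDerivation_X]
  refine Multiset.sum_induction (fun q : Poly => q.IsHomogeneous 1) _ (fun _ _ => .add)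
      (MvPolynomial.isHomogeneous_zero _ _ _) fun q hq => ?_
  obtain ⟨x, hx, rfl⟩ := Multiset.mem_map.1 hq
  exact MvPolynomial.isHomogeneous_X _ _

theorem isHomogeneous_derMinus (s : RTree) {n : ℕ} {p : Poly} (hp : p.IsHomogeneous n) :
    (derMinus s p).IsHomogeneous n := by
  refine isHomogeneous_derivation (fun t => ?_) hp
  rw [derMinus, MvPolynomial.mkDerivation_X]
  refine Multiset.sum_induction (fun q : Poly => q.IsHomogeneous 1) _ (fun _ _ => .add)
      (MvPolynomial.isHomogeneous_zero _ _ _) fun q hq => ?_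
  obtain ⟨x, hx, rfl⟩ := Multiset.mem_map.1 hq
  split_ifs
  · exact MvPolynomial.isHomogeneous_X _ _
  · exact MvPolynomial.isHomogeneous_zero _ _ _

/-- Euler's identity. -/
theorem sum_X_mul_pderiv {n : ℕ} {p : Poly} (hp : p.IsHomogeneous n) {S : Finset RTree}
    (hS : p.vars ⊆ S) : ∑ u ∈ S, X u * pderiv u p = (n : ℂ) • p := by
  have h1 : ∑ u ∈ S, X u * pderiv u p = MvPolynomial.mkDerivation ℂ (X : RTree → Poly) p := by
    have : ∑ u ∈ S, X u * pderiv u p = (∑ u ∈ S, (X u : Poly) • pderiv (R := ℂ) u) p := by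
      rw [← Derivation.coeFnAddMonoidHom_apply, _root_.map_sum, Finset.sum_apply]
      rfl
    rw [this]
    -- A derivation is determined at `p` by its values on the variables of `p`, so the finite sum
    -- over `S` can replace the Euler derivation.
    refine MvPolynomial.derivation_eq_of_forall_mem_vars fun i hi => ?_
    rw [← Derivation.coeFnAddMonoidHom_apply, _root_.map_sum, Finset.sum_apply,
      Finset.sum_eq_single i]
    · simp
    · intro b _ hb
      simp [MvPolynomial.pderiv_X_of_ne hb.symm]
    · exact fun h => absurd (hS hi) h
  rw [h1]
  refine homogeneous_induction (n := n)
    (motive := fun p => MvPolynomial.mkDerivation ℂ (X : RTree → Poly) p = (n : ℂ) • p)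
    (fun c hc => ?_) ?_ ?_ ?_ hp
  · rw [derivation_mon, Multiset.map_congr rfl (g := fun _ => mon c), Multiset.map_const',
      Multiset.sum_replicate, hc, Nat.cast_smul_eq_nsmul]
    intro x hx
    rw [MvPolynomial.mkDerivation_X, ← mon_cons, Multiset.cons_erase hx]
  · simp
  · intro p q hp hq; rw [map_add, hp, hq, smul_add]
  · intro a p hp; rw [Derivation.map_smul, hp, smul_comm]

/-- Exactness of the Koszul complex in degree one: a homogeneous solution of `∑ X_t q_t = 0` comes
from an antisymmetric matrix. -/
theorem exists_antisymm_of_sum_X_mul_eq_zero {k : ℕ} {S : Finset RTree} {q : RTree → Poly}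
    (hq : ∀ t ∈ S, (q t).IsHomogeneous k) (hS : ∀ t ∈ S, (q t).vars ⊆ S)
    (h : ∑ t ∈ S, X t * q t = 0) :
    ∃ a : RTree → RTree → Poly, (∀ t u, a t u = -a u t) ∧
      (∀ t ∈ S, ∀ u ∈ S, (a t u).IsHomogeneous (k - 1)) ∧ (k = 0 → ∀ t ∈ S, ∀ u ∈ S, a t u = 0) ∧
      ∀ t ∈ S, q t = ∑ u ∈ S, X u * a t u := by
  -- This is the Koszul homotopy. Euler's identity gives `∑ X_u ∂_u q_t = k q_t`, and
  -- differentiating the relation by `X_t` gives `∑ X_u ∂_t q_u = -q_t`; their difference is `(k +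
  -- 1) q_t`. For `k = 0` the matrix vanishes, which the truncated degree `k - 1` does not record.
  refine ⟨fun t u => ((k : ℂ) + 1)⁻¹ • (pderiv u (q t) - pderiv t (q u)), fun t u => ?_,
    fun t ht u hu => ?_, ?_, fun t ht => ?_⟩
  · rw [← smul_neg, neg_sub]
  · exact (MvPolynomial.homogeneousSubmodule _ _ _).smul_mem _
      (sub_mem (hq t ht).pderiv (hq u hu).pderiv)
  · rintro rfl t ht u hu
    beta_reduce
    rw [MvPolynomial.totalDegree_eq_zero_iff_eq_C.1 (Nat.le_zero.1 (hq t ht).totalDegree_le),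
      MvPolynomial.totalDegree_eq_zero_iff_eq_C.1 (Nat.le_zero.1 (hq u hu).totalDegree_le)]
    simp
  · have h1 : q t + ∑ u ∈ S, X u * pderiv t (q u) = 0 := by
      have := congrArg (pderiv t) h
      rw [_root_.map_sum, map_zero] at this
      simp only [Derivation.leibniz, smul_eq_mul, Finset.sum_add_distrib] at this
      rw [Finset.sum_eq_single (s := S) (f := fun u => q u * pderiv t (X u)) t] at this
      · simpa [add_comm] using this
      · intro b _ hb
        rw [MvPolynomial.pderiv_X_of_ne hb, mul_zero]
      · exact fun h => absurd ht h
    have hk : (k : ℂ) + 1 ≠ 0 := by exact_mod_cast Nat.succ_ne_zero k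
    simp only [mul_smul_comm, mul_sub, Finset.sum_sub_distrib, ← Finset.smul_sum]
    rw [sum_X_mul_pderiv (hq t ht) (hS t ht), eq_neg_of_add_eq_zero_right h1, sub_neg_eq_add,
      eq_inv_smul_iff₀ hk, add_smul, one_smul]

/-- The action of `𝔤` on polynomials, the monomials of which are the forests. -/
noncomputable def forestAction : InsElimAlgebra →ₗ[ℂ] Module.End ℂ Poly where
  toFun x := LinearMap.mulLeft ℂ (pol x) + (tot x).toLinearMap
  map_add' x y := by
    refine LinearMap.ext fun p => ?_
    simp only [map_add, LinearMap.add_apply, LinearMap.mulLeft_apply, add_mul,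
      Derivation.coeFn_coe, Derivation.add_apply]
    abel
  map_smul' c x := by
    refine LinearMap.ext fun p => ?_
    simp

theorem forestAction_apply (x : InsElimAlgebra) (p : Poly) :
    forestAction x p = pol x * p + tot x p := rfl

theorem forestAction_lie (x y : InsElimAlgebra) (p : Poly) :
    forestAction ⁅x, y⁆ p = forestAction x (forestAction y p) -
      forestAction y (forestAction x p) := by
  change forestAction (bracketₗ x y) p = _
  simp only [forestAction_apply, pol_bracket, tot_bracket, map_add, Derivation.leibniz, smul_eq_mul]
  ring

theorem forestAction_Dp (t : RTree) (p : Poly) :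
    forestAction (Dp t) p = X t * p + derPlus t p := by
  simp [forestAction_apply, pol_Dp, tot, pd_Dp, der_Dp]

/-- The polynomials all of whose monomials have fewer than `k` factors. -/
noncomputable def degLT (k : ℕ) : Submodule ℂ Poly :=
  Submodule.span ℂ {p | ∃ i < k, IsHomogeneous p i}

theorem degLT_mono {k l : ℕ} (h : k ≤ l) : degLT k ≤ degLT l :=
  Submodule.span_mono fun _ ⟨i, hi, hp⟩ => ⟨i, hi.trans_le h, hp⟩

theorem mem_degLT_of_isHomogeneous {k i : ℕ} {p : Poly} (hp : p.IsHomogeneous i) (h : i < k) :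
    p ∈ degLT k := Submodule.subset_span ⟨i, h, hp⟩

theorem exists_mem_degLT (p : Poly) : ∃ k, p ∈ degLT k := by
  refine ⟨p.totalDegree + 1, ?_⟩
  have h : ∑ i ∈ Finset.range (p.totalDegree + 1), MvPolynomial.homogeneousComponent i p ∈
      degLT (p.totalDegree + 1) := sum_mem fun i hi => mem_degLT_of_isHomogeneous
    (MvPolynomial.homogeneousComponent_isHomogeneous i p) (Finset.mem_range.1 hi)
  rwa [p.sum_homogeneousComponent] at h

theorem derPlus_mem_degLT (s : RTree) {k : ℕ} {p : Poly} (hp : p ∈ degLT k) :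
    derPlus s p ∈ degLT k := by
  induction hp using Submodule.span_induction with
  | mem p hp => obtain ⟨i, hi, hp⟩ := hp; exact mem_degLT_of_isHomogeneous (isHomogeneous_derPlus s hp) hi
  | zero => rw [map_zero]; exact zero_mem _
  | add p q _ _ hp hq => rw [map_add]; exact add_mem hp hq
  | smul a p _ hp => rw [Derivation.map_smul]; exact Submodule.smul_mem _ a hp

theorem X_mul_mem_degLT (s : RTree) {k : ℕ} {p : Poly} (hp : p ∈ degLT k) :
    X s * p ∈ degLT (k + 1) := by
  induction hp using Submodule.span_induction with
  | mem p hp =>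
    obtain ⟨i, hi, hp⟩ := hp
    exact mem_degLT_of_isHomogeneous ((MvPolynomial.isHomogeneous_X _ s).mul hp) (by omega)
  | zero => rw [mul_zero]; exact zero_mem _
  | add p q _ _ hp hq => rw [mul_add]; exact add_mem hp hq
  | smul a p _ hp => rw [mul_smul_comm]; exact Submodule.smul_mem _ a hp

theorem forestAction_Dp_mem_degLT (s : RTree) {k : ℕ} {p : Poly} (hp : p ∈ degLT k) :
    forestAction (Dp s) p ∈ degLT (k + 1) := by
  rw [forestAction_Dp]
  exact add_mem (X_mul_mem_degLT s hp) (degLT_mono k.le_succ (derPlus_mem_degLT s hp))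

theorem eq_zero_of_mem_degLT {k : ℕ} {p : Poly} (hp : p ∈ degLT k) (h : p.IsHomogeneous k) :
    p = 0 := by
  have : MvPolynomial.homogeneousComponent k p = 0 := by
    clear h
    induction hp using Submodule.span_induction with
    | mem p hp =>
      obtain ⟨i, hi, hp⟩ := hp
      rw [MvPolynomial.homogeneousComponent_of_mem hp, if_neg hi.ne']
    | zero => simp
    | add p q _ _ hp hq => rw [map_add, hp, hq, add_zero]
    | smul a p _ hp => rw [map_smul, hp, smul_zero]
  rwa [MvPolynomial.homogeneousComponent_of_mem h, if_pos rfl] at this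

/-! ### A Whittaker functional on forest polynomials -/

section Functional

variable (η : LieAlgebra.LieCharacter ℂ nPlus)

/-- The span of the polynomials `(D_t^+ + η (D_t^+)) p`, with `p` having fewer than `k` factors. -/
noncomputable def twistedImage (k : ℕ) : Submodule ℂ Poly :=
  Submodule.span ℂ {z | ∃ t, ∃ p ∈ degLT k, z = forestAction (Dp t) p + η (nPlus.Dp t) • p}

variable {η}

theorem mem_twistedImage {k : ℕ} (t : RTree) {p : Poly} (hp : p ∈ degLT k) :
    forestAction (Dp t) p + η (nPlus.Dp t) • p ∈ twistedImage η k :=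
  Submodule.subset_span ⟨t, p, hp, rfl⟩

theorem nPlus_induction {motive : nPlus → Prop} (hb : ∀ t, motive (nPlus.Dp t)) (h0 : motive 0)
    (ha : ∀ x y, motive x → motive y → motive (x + y))
    (hs : ∀ (c : ℂ) x, motive x → motive (c • x)) (x : nPlus) : motive x := by
  obtain ⟨x, hx⟩ := x
  change x ∈ Submodule.span ℂ (Set.range Dp) at hx
  induction hx using Submodule.span_induction with
  | mem x h => obtain ⟨i, rfl⟩ := h; exact hb i
  | zero => exact h0
  | add x y hx' hy' hx hy => exact ha ⟨x, hx'⟩ ⟨y, hy'⟩ hx hy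
  | smul c x hx' hx => exact hs c ⟨x, hx'⟩ hx

theorem nPlus_mem_twistedImage {k : ℕ} (x : nPlus) {p : Poly} (hp : p ∈ degLT k) :
    forestAction x p + η x • p ∈ twistedImage η k := by
  induction x using nPlus_induction with
  | hb t => exact mem_twistedImage t hp
  | h0 => simp
  | ha x y hx hy =>
    convert add_mem hx hy using 1
    have hxy : ((x + y : nPlus) : InsElimAlgebra) = x + y := rfl
    simp only [hxy, map_add, LinearMap.add_apply, add_smul]
    abel
  | hs c x hx =>
    convert Submodule.smul_mem _ c hx using 1
    simp [smul_smul]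

/-- Isolates the part of the coefficients of top degree `k`; coefficients of smaller degree are
absorbed into `twistedImage η k`. -/
theorem mem_twistedImage_succ {k : ℕ} {z : Poly} (hz : z ∈ twistedImage η (k + 1)) :
    ∃ q : RTree →₀ Poly, (∀ t, (q t).IsHomogeneous k) ∧
      z - q.sum (fun t p => forestAction (Dp t) p + η (nPlus.Dp t) • p) ∈ twistedImage η k := by
  have hadd : ∀ t (p q : Poly), forestAction (Dp t) (p + q) + η (nPlus.Dp t) • (p + q) =
      (forestAction (Dp t) p + η (nPlus.Dp t) • p) +
        (forestAction (Dp t) q + η (nPlus.Dp t) • q) := by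
    intro t p q
    rw [map_add, smul_add]; abel
  induction hz using Submodule.span_induction with
  | mem z hz =>
    obtain ⟨t, p, hp, rfl⟩ := hz
    induction hp using Submodule.span_induction with
    | mem p hp =>
      obtain ⟨i, hi, hp⟩ := hp
      rcases (Nat.lt_succ_iff.1 hi).lt_or_eq with h | rfl
      · refine ⟨0, fun t => MvPolynomial.isHomogeneous_zero _ _ _, ?_⟩
        rw [Finsupp.sum_zero_index, sub_zero]
        exact mem_twistedImage t (mem_degLT_of_isHomogeneous hp h)
      · refine ⟨Finsupp.single t p, fun u => ?_, ?_⟩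
        · rw [Finsupp.single_apply]
          split_ifs
          · exact hp
          · exact MvPolynomial.isHomogeneous_zero _ _ _
        · rw [Finsupp.sum_single_index (by simp), sub_self]
          exact zero_mem _
    | zero => exact ⟨0, fun t => MvPolynomial.isHomogeneous_zero _ _ _, by simp⟩
    | add p p' _ _ h h' =>
      obtain ⟨q, hq, h⟩ := h
      obtain ⟨q', hq', h'⟩ := h'
      refine ⟨q + q', fun t => (hq t).add (hq' t), ?_⟩
      rw [Finsupp.sum_add_index' (by simp) hadd, hadd, add_sub_add_comm]
      exact add_mem h h'
    | smul a p _ h =>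
      obtain ⟨q, hq, h⟩ := h
      refine ⟨a • q, fun t => (MvPolynomial.homogeneousSubmodule _ _ _).smul_mem a (hq t), ?_⟩
      rw [Finsupp.sum_smul_index' (by simp)]
      simp only [map_smul, smul_comm _ a, ← smul_add]
      rw [← Finsupp.smul_sum, ← smul_sub]
      exact Submodule.smul_mem _ a h
  | zero => exact ⟨0, fun t => MvPolynomial.isHomogeneous_zero _ _ _, by simp⟩
  | add p p' _ _ h h' =>
    obtain ⟨q, hq, h⟩ := h
    obtain ⟨q', hq', h'⟩ := h'
    refine ⟨q + q', fun t => (hq t).add (hq' t), ?_⟩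
    rw [Finsupp.sum_add_index' (by simp) hadd, add_sub_add_comm]
    exact add_mem h h'
  | smul a p _ h =>
    obtain ⟨q, hq, h⟩ := h
    refine ⟨a • q, fun t => (MvPolynomial.homogeneousSubmodule _ _ _).smul_mem a (hq t), ?_⟩
    rw [Finsupp.sum_smul_index' (by simp)]
    simp only [map_smul, smul_comm _ a, ← smul_add]
    rw [← Finsupp.smul_sum, ← smul_sub]
    exact Submodule.smul_mem _ a h

theorem twistedImage_le_degLT (k : ℕ) : twistedImage η k ≤ degLT (k + 1) := by
  refine Submodule.span_le.2 ?_
  rintro _ ⟨t, p, hp, rfl⟩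
  exact add_mem (forestAction_Dp_mem_degLT t hp)
    (Submodule.smul_mem _ _ (degLT_mono k.le_succ hp))

/-- By antisymmetry the terms for `(t, u)` and `(u, t)` add up to `[D_t^+, D_u^+]` applied to `a t
u`. Since `η` vanishes on brackets, this is again a twisted image, with no increase in the degree of
the coefficient. -/
theorem antisymm_sum_mem_twistedImage {k : ℕ} (S : Finset RTree) {a : RTree → RTree → Poly}
    (ha : ∀ t u, a t u = -a u t) (hk : ∀ t ∈ S, ∀ u ∈ S, a t u ∈ degLT k) :
    ∑ t ∈ S, ∑ u ∈ S, (forestAction (Dp t) (forestAction (Dp u) (a t u) +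
      η (nPlus.Dp u) • a t u) + η (nPlus.Dp t) • (forestAction (Dp u) (a t u) +
      η (nPlus.Dp u) • a t u)) ∈ twistedImage η k := by
  set f : RTree → RTree → Poly := fun t u => forestAction (Dp t) (forestAction (Dp u) (a t u) +
      η (nPlus.Dp u) • a t u) + η (nPlus.Dp t) • (forestAction (Dp u) (a t u) +
      η (nPlus.Dp u) • a t u) with hf
  have h2 : (2 : ℂ) • ∑ t ∈ S, ∑ u ∈ S, f t u = ∑ t ∈ S, ∑ u ∈ S, (f t u + f u t) := by
    simp only [Finset.sum_add_distrib]
    rw [two_smul, Finset.sum_comm (f := fun t u => f u t)]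
  have h3 : (2 : ℂ) • ∑ t ∈ S, ∑ u ∈ S, f t u ∈ twistedImage η k := by
    rw [h2]
    refine sum_mem fun t ht => sum_mem fun u hu => ?_
    have := nPlus_mem_twistedImage (η := η) ⁅nPlus.Dp t, nPlus.Dp u⁆ (hk t ht u hu)
    rw [LieAlgebra.lieCharacter_apply_lie, zero_smul, add_zero, LieSubalgebra.coe_bracket,
      forestAction_lie] at this
    convert this using 1
    change f t u + f u t = forestAction (Dp t) (forestAction (Dp u) _) -
      forestAction (Dp u) (forestAction (Dp t) _)
    simp only [hf, ha u t, map_add, map_smul, map_neg, smul_add, smul_neg]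
    rw [smul_comm (η (nPlus.Dp t))]
    abel
  exact (Submodule.smul_mem_iff _ two_ne_zero).1 h3

/-- If the degree of a combination drops, its top coefficients `q_t` satisfy `∑ X_t q_t = 0`, so
they come from an antisymmetric matrix `a`. Replacing `X_u` by `D_u^+ + η(D_u^+)` in `q_t = ∑ X_u
a_tu` changes only lower-degree coefficients, and the remaining antisymmetric double sum is handled
by the bracket argument. -/
theorem twistedImage_succ_inf_degLT (k : ℕ) {z : Poly} (hz : z ∈ twistedImage η (k + 1))
    (hk : z ∈ degLT (k + 1)) : z ∈ twistedImage η k := by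
  obtain ⟨q, hq, h⟩ := mem_twistedImage_succ hz
  set S : Finset RTree := q.support ∪ q.support.biUnion fun t => (q t).vars with hS
  have hqS : q.sum (fun t p => forestAction (Dp t) p + η (nPlus.Dp t) • p) =
      ∑ t ∈ S, (forestAction (Dp t) (q t) + η (nPlus.Dp t) • q t) :=
    Finsupp.sum_of_support_subset _ Finset.subset_union_left _ (by simp)
  rw [hqS] at h
  have hvars : ∀ t ∈ S, (q t).vars ⊆ S := by
    intro t _
    by_cases ht : t ∈ q.support
    · exact (Finset.subset_biUnion_of_mem (fun t => (q t).vars) ht).trans Finset.subset_union_right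
    · rw [Finsupp.notMem_support_iff.1 ht]; simp
  -- The sum is homogeneous of degree `k + 1`, but modulo lower degree it equals `z`, which has no
  -- component in that degree.
  have h0 : ∑ t ∈ S, X t * q t = 0 := by
    refine eq_zero_of_mem_degLT (k := k + 1) ?_ ?_
    · have h1 : ∑ t ∈ S, X t * q t = z - (z - ∑ t ∈ S, (forestAction (Dp t) (q t) +
          η (nPlus.Dp t) • q t)) - ∑ t ∈ S, (derPlus t (q t) + η (nPlus.Dp t) • q t) := by
        simp only [forestAction_Dp, Finset.sum_add_distrib]
        abel
      rw [h1]
      refine sub_mem (sub_mem hk (twistedImage_le_degLT k h)) (sum_mem fun t _ => add_mem ?_ ?_)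
      · exact mem_degLT_of_isHomogeneous (isHomogeneous_derPlus t (hq t)) k.lt_succ_self
      · exact Submodule.smul_mem _ _ (mem_degLT_of_isHomogeneous (hq t) k.lt_succ_self)
    · refine MvPolynomial.IsHomogeneous.sum _ _ _ fun t _ => ?_
      rw [add_comm]
      exact (MvPolynomial.isHomogeneous_X _ t).mul (hq t)
  obtain ⟨a, ha, hak, hak0, haq⟩ := exists_antisymm_of_sum_X_mul_eq_zero (fun t _ => hq t) hvars h0
  have hdeg : ∀ t ∈ S, ∀ u ∈ S, a t u ∈ degLT k := by
    intro t ht u hu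
    rcases Nat.eq_zero_or_pos k with h | h
    · rw [hak0 h t ht u hu]; exact zero_mem _
    · exact mem_degLT_of_isHomogeneous (hak t ht u hu) (by omega)
  have hsplit : ∀ t ∈ S, q t = ∑ u ∈ S, (forestAction (Dp u) (a t u) + η (nPlus.Dp u) • a t u) -
      ∑ u ∈ S, (derPlus u (a t u) + η (nPlus.Dp u) • a t u) := by
    intro t ht
    rw [haq t ht]
    simp only [forestAction_Dp, Finset.sum_add_distrib]
    abel
  have hmem : ∑ t ∈ S, (forestAction (Dp t) (q t) + η (nPlus.Dp t) • q t) ∈ twistedImage η k := by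
    have h1 : ∑ t ∈ S, (forestAction (Dp t) (q t) + η (nPlus.Dp t) • q t) =
        ∑ t ∈ S, ∑ u ∈ S, (forestAction (Dp t) (forestAction (Dp u) (a t u) +
          η (nPlus.Dp u) • a t u) + η (nPlus.Dp t) • (forestAction (Dp u) (a t u) +
          η (nPlus.Dp u) • a t u)) -
        ∑ t ∈ S, (forestAction (Dp t) (∑ u ∈ S, (derPlus u (a t u) + η (nPlus.Dp u) • a t u)) +
          η (nPlus.Dp t) • ∑ u ∈ S, (derPlus u (a t u) + η (nPlus.Dp u) • a t u)) := by
      rw [← Finset.sum_sub_distrib]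
      refine Finset.sum_congr rfl fun t ht => ?_
      rw [Finset.sum_add_distrib, ← _root_.map_sum, ← Finset.smul_sum, add_sub_add_comm,
        ← map_sub, ← smul_sub, ← hsplit t ht]
    rw [h1]
    refine sub_mem (antisymm_sum_mem_twistedImage S ha hdeg) (sum_mem fun t ht =>
      mem_twistedImage t (sum_mem fun u hu => add_mem ?_ ?_))
    · exact derPlus_mem_degLT u (hdeg t ht u hu)
    · exact Submodule.smul_mem _ _ (hdeg t ht u hu)
  have := add_mem h hmem
  rwa [sub_add_cancel] at this

/-- The constant `1` has degree zero, so the previous strictness descends step by step to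
`twistedImage η 0`, which is zero. -/
theorem one_notMem_twistedImage (k : ℕ) : (1 : Poly) ∉ twistedImage η k := by
  induction k with
  | zero =>
    intro h
    have h0 : twistedImage η 0 ≤ ⊥ := by
      refine Submodule.span_le.2 ?_
      rintro _ ⟨t, p, hp, rfl⟩
      have : degLT 0 = ⊥ := by
        refine (Submodule.span_eq_bot).2 ?_
        rintro p ⟨i, hi, _⟩
        exact absurd hi (Nat.not_lt_zero i)
      rw [this, Submodule.mem_bot] at hp
      simp [hp]
    exact one_ne_zero ((Submodule.mem_bot ℂ).1 (h0 h))
  | succ k ih =>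
    exact fun h => ih (twistedImage_succ_inf_degLT k h
      (mem_degLT_of_isHomogeneous (MvPolynomial.isHomogeneous_one _ _) k.succ_pos))

variable (η)

/-- A linear functional on polynomials that is a Whittaker vector in the dual of `forestAction`. -/
theorem exists_whittaker_functional : ∃ ψ : Poly →ₗ[ℂ] ℂ, ψ 1 = 1 ∧
    ∀ t p, ψ (forestAction (Dp t) p) = -(η (nPlus.Dp t) * ψ p) := by
  have hmono : Monotone (twistedImage η) := fun k l h => Submodule.span_mono
    fun _ ⟨t, p, hp, hz⟩ => ⟨t, p, degLT_mono h hp, hz⟩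
  have h1 : (1 : Poly) ∉ ⨆ k, twistedImage η k := by
    rw [Submodule.mem_iSup_of_directed _ hmono.directed_le]
    exact fun ⟨k, hk⟩ => one_notMem_twistedImage k hk
  obtain ⟨f, hf1, hf⟩ := Submodule.exists_le_ker_of_notMem h1
  -- The functional kills `(D_t^+ + η(D_t^+)) p`. The contragredient action carries a minus sign, so
  -- its eigenvalue there is `+η(D_t^+)`.
  refine ⟨(f 1)⁻¹ • f, by simp [hf1], fun t p => ?_⟩
  obtain ⟨k, hk⟩ := exists_mem_degLT p
  have := hf (Submodule.mem_iSup_of_mem k (mem_twistedImage (η := η) t hk))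
  rw [LinearMap.mem_ker, map_add, map_smul, smul_eq_mul] at this
  simp only [LinearMap.smul_apply, smul_eq_mul, eq_neg_of_add_eq_zero_left this]
  ring

end Functional

/-- The elements satisfying the motive form a subalgebra containing the image of `ι`. The universal
property gives a map into this subalgebra whose composite with the inclusion is the identity. -/
theorem UEA_induction {L : Type*} [LieRing L] [LieAlgebra ℂ L]
    {motive : UniversalEnvelopingAlgebra ℂ L → Prop}
    (hι : ∀ x, motive (UniversalEnvelopingAlgebra.ι ℂ x)) (hc : ∀ c : ℂ, motive (algebraMap ℂ _ c))
    (ha : ∀ a b, motive a → motive b → motive (a + b))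
    (hm : ∀ a b, motive a → motive b → motive (a * b)) (a : UniversalEnvelopingAlgebra ℂ L) :
    motive a := by
  let S : Subalgebra ℂ (UniversalEnvelopingAlgebra ℂ L) :=
    { carrier := {a | motive a}
      mul_mem' := fun {a b} => hm a b
      add_mem' := fun {a b} => ha a b
      algebraMap_mem' := hc }
  let f : L →ₗ⁅ℂ⁆ S :=
    { toFun := fun x => ⟨UniversalEnvelopingAlgebra.ι ℂ x, hι x⟩
      map_add' := fun x y => Subtype.ext (map_add _ _ _)
      map_smul' := fun c x => Subtype.ext (map_smul _ _ _)
      map_lie' := fun {x y} => Subtype.ext (LieHom.map_lie _ _ _) }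
  have h : S.val.comp (UniversalEnvelopingAlgebra.lift ℂ f) =
      AlgHom.id ℂ (UniversalEnvelopingAlgebra ℂ L) := by
    refine UniversalEnvelopingAlgebra.hom_ext ℂ (LieHom.ext fun x => ?_)
    change ((UniversalEnvelopingAlgebra.lift ℂ f) (UniversalEnvelopingAlgebra.ι ℂ x) : _) =
      UniversalEnvelopingAlgebra.ι ℂ x
    rw [UniversalEnvelopingAlgebra.lift_ι_apply]
    rfl
  have h1 := AlgHom.congr_fun h a
  change ((UniversalEnvelopingAlgebra.lift ℂ f) a : _) = a at h1
  rw [← h1]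
  exact ((UniversalEnvelopingAlgebra.lift ℂ f) a).2

/-- The representation of `𝔤` on linear functionals contragredient to `forestAction`. -/
noncomputable def dualAction : InsElimAlgebra →ₗ⁅ℂ⁆ Module.End ℂ (Poly →ₗ[ℂ] ℂ) where
  toFun x := -LinearMap.lcomp ℂ ℂ (forestAction x)
  map_add' x y := by
    refine LinearMap.ext fun φ => LinearMap.ext fun p => ?_
    simp [add_comm]
  map_smul' c x := by
    refine LinearMap.ext fun φ => LinearMap.ext fun p => ?_
    simp
  map_lie' {x y} := by
    refine LinearMap.ext fun φ => LinearMap.ext fun p => ?_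
    rw [LieRing.of_associative_ring_bracket]
    simp [forestAction_lie]

/-! ### Nonvanishing of the cyclic vector -/

section Module

variable (η : LieAlgebra.LieCharacter ℂ nPlus)

/-- The cyclic vector `1 ⊗ 1` of the standard Whittaker module. -/
noncomputable def cyclicVector : StandardWhittaker η := (balancing η).mkQ (1 ⊗ₜ[ℂ] 1)

theorem mkQ_tmul (a : Ug) (z : ℂ) :
    (balancing η).mkQ (a ⊗ₜ[ℂ] z) = z • a • cyclicVector η := by
  rw [cyclicVector, ← map_smul, TensorProduct.smul_tmul', smul_eq_mul, mul_one,
    ← LinearMap.map_smul_of_tower, ← TensorProduct.tmul_smul, smul_eq_mul, mul_one]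

theorem ι_smul_cyclicVector (x : nPlus) :
    UniversalEnvelopingAlgebra.ι ℂ (x : InsElimAlgebra) • cyclicVector η =
      η x • cyclicVector η := by
  have h : (1 * UnPlus.incl (UniversalEnvelopingAlgebra.ι ℂ x)) ⊗ₜ[ℂ] (1 : ℂ) -
      1 ⊗ₜ[ℂ] (UnPlus.char η (UniversalEnvelopingAlgebra.ι ℂ x) * 1) ∈ balancing η :=
    Submodule.subset_span ⟨_, _, _, rfl⟩
  have h1 : UnPlus.incl (UniversalEnvelopingAlgebra.ι ℂ x) =
      UniversalEnvelopingAlgebra.ι ℂ (x : InsElimAlgebra) := by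
    rw [UnPlus.incl, UniversalEnvelopingAlgebra.lift_ι_apply]; rfl
  have h2 : UnPlus.char η (UniversalEnvelopingAlgebra.ι ℂ x) = η x := by
    rw [UnPlus.char, UniversalEnvelopingAlgebra.lift_ι_apply]
  rw [h1, h2, one_mul, mul_one, ← Submodule.ker_mkQ (balancing η), LinearMap.mem_ker, map_sub,
    mkQ_tmul, mkQ_tmul, one_smul, one_smul, sub_eq_zero] at h
  exact h

theorem cyclicVector_generates (v : StandardWhittaker η) : ∃ a : Ug, v = a • cyclicVector η := by
  obtain ⟨y, rfl⟩ := (balancing η).mkQ_surjective v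
  induction y using TensorProduct.induction_on with
  | zero => exact ⟨0, by simp⟩
  | tmul a z => exact ⟨z • a, by rw [mkQ_tmul, smul_assoc]⟩
  | add y y' h h' =>
    obtain ⟨a, h⟩ := h
    obtain ⟨a', h'⟩ := h'
    exact ⟨a + a', by rw [map_add, h, h', add_smul]⟩

/-- The functional `ψ` is a Whittaker vector of type `η` in the dual of the forest module. Hence `a
⊗ z ↦ z • a ψ` kills the balancing relations and sends `1 ⊗ 1` to `ψ`, which is nonzero because `ψ 1
= 1`. -/
theorem cyclicVector_ne_zero : cyclicVector η ≠ 0 := by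
  obtain ⟨ψ, hψ1, hψ⟩ := exists_whittaker_functional η
  let Θ : Ug →ₐ[ℂ] Module.End ℂ (Poly →ₗ[ℂ] ℂ) := UniversalEnvelopingAlgebra.lift ℂ dualAction
  have hn : ∀ x : nPlus, dualAction x ψ = η x • ψ := by
    intro x
    induction x using nPlus_induction with
    | hb t =>
      refine LinearMap.ext fun p => ?_
      change -ψ (forestAction (Dp t) p) = _
      rw [hψ, neg_neg]; rfl
    | h0 => simp
    | ha x y hx hy =>
      have hxy : ((x + y : nPlus) : InsElimAlgebra) = x + y := rfl
      rw [hxy, map_add, LinearMap.add_apply, hx, hy, map_add, add_smul]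
    | hs c x hx =>
      have hxy : ((c • x : nPlus) : InsElimAlgebra) = c • (x : InsElimAlgebra) := rfl
      rw [hxy, map_smul, LinearMap.smul_apply, hx, map_smul, smul_assoc]
  have hb : ∀ b : UnPlus, Θ (UnPlus.incl b) ψ = UnPlus.char η b • ψ := by
    intro b
    induction b using UEA_induction with
    | hι x =>
      have h1 : UnPlus.incl (UniversalEnvelopingAlgebra.ι ℂ x) =
          UniversalEnvelopingAlgebra.ι ℂ (x : InsElimAlgebra) := by
        rw [UnPlus.incl, UniversalEnvelopingAlgebra.lift_ι_apply]; rfl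
      rw [h1, UnPlus.char, UniversalEnvelopingAlgebra.lift_ι_apply,
        UniversalEnvelopingAlgebra.lift_ι_apply]
      exact hn x
    | hc c => simp [Algebra.algebraMap_eq_smul_one]
    | ha a b ha hb => rw [map_add, map_add, LinearMap.add_apply, ha, hb, map_add, add_smul]
    | hm a b ha hb =>
      rw [map_mul, map_mul, Module.End.mul_apply, hb, map_smul, ha, map_mul, smul_smul, mul_comm]
  let F : Ug ⊗[ℂ] ℂ →ₗ[ℂ] (Poly →ₗ[ℂ] ℂ) :=
    (LinearMap.applyₗ ψ ∘ₗ Θ.toLinearMap) ∘ₗ (TensorProduct.rid ℂ Ug).toLinearMap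
  have hF : ∀ a z, F (a ⊗ₜ[ℂ] z) = z • Θ a ψ := by
    intro a z
    simp [F]
  have hFs : ∀ (a : Ug) y, F (a • y) = Θ a (F y) := by
    intro a y
    induction y using TensorProduct.induction_on with
    | zero => simp
    | tmul b z =>
      rw [TensorProduct.smul_tmul', hF, hF, smul_eq_mul, map_mul, Module.End.mul_apply, map_smul]
    | add y y' h h' => rw [smul_add, map_add, h, h', map_add, map_add]
  have hker : ∀ y ∈ balancing η, F y = 0 := by
    intro y hy
    induction hy using Submodule.span_induction with
    | mem y hy =>
      obtain ⟨a, b, z, rfl⟩ := hy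
      rw [map_sub, hF, hF, map_mul, Module.End.mul_apply, hb, map_smul, smul_smul, mul_comm,
        sub_self]
    | zero => exact map_zero _
    | add y y' _ _ h h' => rw [map_add, h, h', add_zero]
    | smul a y _ h => rw [hFs, h, map_zero]
  intro h
  rw [cyclicVector, Submodule.mkQ_apply, Submodule.Quotient.mk_eq_zero] at h
  have := hker _ h
  rw [hF, one_smul, map_one, Module.End.one_apply] at this
  rw [this] at hψ1
  simp at hψ1

end Module

/-- `w` is a nonzero Whittaker vector generating the `𝔤`-module `V` with action `ρ`; the number
`e t` is the eigenvalue of `D_t^+` on `w`. -/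
structure IsCyclicWhittaker {V : Type*} [AddCommGroup V] [Module ℂ V]
    (ρ : InsElimAlgebra →ₗ[ℂ] Module.End ℂ V) (e : RTree → ℂ) (w : V) : Prop where
  lie : ∀ x y v, ρ ⁅x, y⁆ v = ρ x (ρ y v) - ρ y (ρ x v)
  whittaker : ∀ t, ρ (Dp t) w = e t • w
  ne_zero : w ≠ 0
  cyclic : ∀ N : Submodule ℂ V, w ∈ N → (∀ x, ∀ v ∈ N, ρ x v ∈ N) → N = ⊤

theorem finsum_smul_mem {V : Type*} [AddCommGroup V] [Module ℂ V] {N : Submodule ℂ V}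
    {c : RTree → ℂ} {f : RTree → V} (h : ∀ r, c r ≠ 0 → f r ∈ N) : ∑ᶠ r, c r • f r ∈ N := by
  refine finsum_induction (· ∈ N) (zero_mem _) (fun _ _ => add_mem) fun r => ?_
  by_cases hr : c r = 0
  · rw [hr, zero_smul]; exact zero_mem _
  · exact N.smul_mem _ (h r hr)

/-- The basis elements `d` and `D_t^-`, indexed by `none` and `some t`. -/
noncomputable def lowering : Option RTree → InsElimAlgebra
  | none => d
  | some t => Dm t

/-- The size of an index of `lowering`. -/
def lsize : Option RTree → ℕ
  | none => 0
  | some t => t.size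

/-! ### The filtration by words and descent to Whittaker vectors -/

section Words

variable {V : Type*} [AddCommGroup V] [Module ℂ V] (ρ : InsElimAlgebra →ₗ[ℂ] Module.End ℂ V)
  (e : RTree → ℂ) (w : V)

/-- The product of lowering operators given by a list, applied to `w`. -/
noncomputable def word : List (Option RTree) → V
  | [] => w
  | y :: l => ρ (lowering y) (word l)

/-- The total size of the trees in a list of lowering operators. -/
def wsize (l : List (Option RTree)) : ℕ := (l.map lsize).sum

/-- The span of the words that either have fewer than `k` letters, or have `k` letters and total
size less than `n`. -/
noncomputable def wordSpan (k n : ℕ) : Submodule ℂ V :=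
  Submodule.span ℂ {v | ∃ l : List (Option RTree),
    (l.length < k ∨ (l.length = k ∧ wsize l < n)) ∧ v = word ρ w l}

/-- The operator `D_s^+ - e s`. -/
noncomputable def shifted (s : RTree) : V →ₗ[ℂ] V := ρ (Dp s) - e s • LinearMap.id

theorem shifted_apply (s : RTree) (v : V) : shifted ρ e s v = ρ (Dp s) v - e s • v := rfl

variable {ρ e w}

theorem Dp_eq_shifted (s : RTree) (v : V) : ρ (Dp s) v = shifted ρ e s v + e s • v := by
  rw [shifted_apply, sub_add_cancel]

theorem wordSpan_mono {k n k' n' : ℕ} (h : k < k' ∨ (k = k' ∧ n ≤ n')) :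
    wordSpan ρ w k n ≤ wordSpan ρ w k' n' := by
  refine Submodule.span_mono ?_
  rintro v ⟨l, hl, rfl⟩
  exact ⟨l, by omega, rfl⟩

theorem word_mem {k n : ℕ} {l : List (Option RTree)}
    (h : l.length < k ∨ (l.length = k ∧ wsize l < n)) : word ρ w l ∈ wordSpan ρ w k n :=
  Submodule.subset_span ⟨l, h, rfl⟩

theorem wordSpan_zero : wordSpan ρ w 0 0 = ⊥ := by
  refine Submodule.span_eq_bot.2 ?_
  rintro v ⟨l, hl, rfl⟩
  omega

theorem wsize_cons (y : Option RTree) (l : List (Option RTree)) :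
    wsize (y :: l) = lsize y + wsize l := by simp [wsize]

theorem lowering_mem {k n : ℕ} (y : Option RTree) {v : V} (hv : v ∈ wordSpan ρ w k n) :
    ρ (lowering y) v ∈ wordSpan ρ w (k + 1) (n + lsize y) := by
  induction hv using Submodule.span_induction with
  | mem v hv =>
    obtain ⟨l, hl, rfl⟩ := hv
    refine word_mem (l := y :: l) ?_
    rw [wsize_cons, List.length_cons]
    omega
  | zero => rw [map_zero]; exact zero_mem _
  | add v v' _ _ h h' => rw [map_add]; exact add_mem h h'
  | smul c v _ h => rw [map_smul]; exact Submodule.smul_mem _ c h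

theorem lowering_mem' {k : ℕ} (y : Option RTree) {v : V} (hv : v ∈ wordSpan ρ w k 0) :
    ρ (lowering y) v ∈ wordSpan ρ w (k + 1) 0 := by
  induction hv using Submodule.span_induction with
  | mem v hv =>
    obtain ⟨l, hl, rfl⟩ := hv
    refine word_mem (l := y :: l) ?_
    rw [List.length_cons]
    omega
  | zero => rw [map_zero]; exact zero_mem _
  | add v v' _ _ h h' => rw [map_add]; exact add_mem h h'
  | smul c v _ h => rw [map_smul]; exact Submodule.smul_mem _ c h

theorem ρ_finsum {c : RTree → ℕ} (hc : {r | c r ≠ 0}.Finite) (D : RTree → InsElimAlgebra) (v : V) :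
    ρ (∑ᶠ r, (c r : ℂ) • D r) v = ∑ᶠ r, (c r : ℂ) • ρ (D r) v :=
  InsElimAlgebra.map_sum (cast_finite hc) (LinearMap.applyₗ v ∘ₗ ρ) D

/-- Fewer than `k + 1` letters means at most `k`, and the finitely many words involved have bounded
total size. This is the step from `(k + 1, 0)` to some `(k, n)` in the lexicographic descent. -/
theorem exists_mem_wordSpan_of_succ {k : ℕ} {v : V} (hv : v ∈ wordSpan ρ w (k + 1) 0) :
    ∃ n, v ∈ wordSpan ρ w k n := by
  have hdir : Monotone fun n => wordSpan ρ w k n := fun k l h => wordSpan_mono (by omega)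
  suffices v ∈ ⨆ n, wordSpan ρ w k n by
    rwa [Submodule.mem_iSup_of_directed _ hdir.directed_le] at this
  refine Submodule.span_le.2 ?_ hv
  rintro _ ⟨l, hl, rfl⟩
  exact Submodule.mem_iSup_of_mem (wsize l + 1) (word_mem (by omega))

/-- The elements `d` and `D_t^-` span a subalgebra, so a bracket of two letters is a combination of
single letters. -/
theorem lie_lowering_mem (y z : Option RTree) {v : V} {N : Submodule ℂ V}
    (h : ∀ x, ρ (lowering x) v ∈ N) : ρ ⁅lowering y, lowering z⁆ v ∈ N := by
  rcases y with _ | s <;> rcases z with _ | t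
  · simp
  · rw [show ⁅lowering none, lowering (some t)⁆ = -((t.size : ℂ) • Dm t) from
      lie_basis .d (.minus t)]
    rw [map_neg, map_smul, LinearMap.neg_apply, LinearMap.smul_apply]
    exact N.neg_mem (N.smul_mem (t.size : ℂ) (h (some t)))
  · rw [show ⁅lowering (some s), lowering none⁆ = (s.size : ℂ) • Dm s from
      lie_basis (.minus s) .d]
    rw [map_smul, LinearMap.smul_apply]
    exact N.smul_mem (s.size : ℂ) (h (some s))
  · rw [show ⁅lowering (some s), lowering (some t)⁆ =
      ∑ᶠ r, ((alpha t r s : ℂ) - (alpha s r t : ℂ)) • Dm r from lie_basis (.minus s) (.minus t)]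
    have := InsElimAlgebra.map_sum (cast_sub_finite (finite_alpha' t s) (finite_alpha' s t))
      (LinearMap.applyₗ v ∘ₗ ρ) Dm
    rw [show ρ (∑ᶠ r, ((alpha t r s : ℂ) - (alpha s r t : ℂ)) • Dm r) v = _ from this]
    exact finsum_smul_mem fun r _ => h (some r)

namespace IsCyclicWhittaker

variable (H : IsCyclicWhittaker ρ e w)
include H

theorem ρ_comm (x y : InsElimAlgebra) (v : V) : ρ x (ρ y v) = ρ y (ρ x v) + ρ ⁅x, y⁆ v := by
  rw [H.lie]; abel

theorem Dp_d (s : RTree) (v : V) : ρ (Dp s) (ρ d v) = ρ d (ρ (Dp s) v) - (s.size : ℂ) • ρ (Dp s) v := by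
  rw [H.ρ_comm, show ⁅Dp s, d⁆ = -((s.size : ℂ) • Dp s) from lie_basis (.plus s) .d]
  simp [sub_eq_add_neg]

theorem Dp_Dm (s t : RTree) (v : V) : ρ (Dp s) (ρ (Dm t) v) = ρ (Dm t) (ρ (Dp s) v) -
    (∑ᶠ r, (alpha t s r : ℂ) • ρ (Dp r) v + ∑ᶠ r, (beta t s r : ℂ) • ρ (Dm r) v +
      if t = s then ρ d v else 0) := by
  rw [H.ρ_comm, show ⁅Dp s, Dm t⁆ = basisBracket (.plus s) (.minus t) from
    lie_basis (.plus s) (.minus t), basisBracket]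
  simp only [map_neg, map_add, LinearMap.neg_apply, LinearMap.add_apply,
    ρ_finsum (finite_alpha t s), ρ_finsum (finite_beta t s), sub_eq_add_neg]
  congr 3
  split_ifs <;> simp

theorem shifted_d (s : RTree) (v : V) : shifted ρ e s (ρ d v) = ρ d (shifted ρ e s v) -
    (s.size : ℂ) • ρ (Dp s) v := by
  rw [shifted_apply, shifted_apply, H.Dp_d, map_sub, map_smul]; abel

theorem shifted_Dm (s t : RTree) (v : V) : shifted ρ e s (ρ (Dm t) v) =
    ρ (Dm t) (shifted ρ e s v) -
    (∑ᶠ r, (alpha t s r : ℂ) • ρ (Dp r) v + ∑ᶠ r, (beta t s r : ℂ) • ρ (Dm r) v +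
      if t = s then ρ d v else 0) := by
  rw [shifted_apply, shifted_apply, H.Dp_Dm, map_sub, map_smul]; abel

theorem shifted_w (s : RTree) : shifted ρ e s w = 0 := by
  rw [shifted_apply, H.whittaker, sub_self]

/-- Moving `D_s^+` past a letter `D_t^-` gives three kinds of terms: some `D_r^+` with one letter
lost; some `D_r^-` with `|t| = |s| + |r|`, so that the size drops; or `d`, of size zero, in place of
`D_t^-`. Moving it past `d` loses a letter. On `w` itself the shifted operator is zero. -/
theorem shifted_word_mem (s : RTree) (l : List (Option RTree)) :
    shifted ρ e s (word ρ w l) ∈ wordSpan ρ w l.length (wsize l) := by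
  induction l generalizing s with
  | nil => rw [word, H.shifted_w]; exact zero_mem _
  | cons y l ih =>
    have h1 := lowering_mem y (ih s)
    have hw : word ρ w l ∈ wordSpan ρ w (l.length + 1) 0 := word_mem (by omega)
    have hp : ∀ r, ρ (Dp r) (word ρ w l) ∈ wordSpan ρ w (l.length + 1) 0 := fun r => by
      rw [Dp_eq_shifted (e := e)]
      exact add_mem (wordSpan_mono (by omega) (ih r)) (Submodule.smul_mem _ _ hw)
    have h0 : ∀ n, wordSpan ρ w (l.length + 1) 0 ≤ wordSpan ρ w (l.length + 1) n := fun n =>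
      wordSpan_mono (by omega)
    rw [word, wsize_cons, List.length_cons, add_comm (lsize y)]
    rcases y with _ | t
    · rw [lowering, H.shifted_d]
      exact sub_mem h1 (Submodule.smul_mem _ _ (h0 _ (hp s)))
    · rw [lowering, H.shifted_Dm]
      refine sub_mem h1 (add_mem (add_mem ?_ ?_) ?_)
      · exact finsum_smul_mem fun r _ => h0 _ (hp r)
      · refine finsum_smul_mem fun r hr => word_mem (l := some r :: l) (Or.inr ⟨rfl, ?_⟩)
        have := size_of_beta_ne_zero (Nat.cast_ne_zero.1 hr)
        have := s.size_pos
        simp only [wsize_cons, lsize]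
        omega
      · split_ifs
        · refine word_mem (l := none :: l) (Or.inr ⟨rfl, ?_⟩)
          have := t.size_pos
          simp only [wsize_cons, lsize]
          omega
        · exact zero_mem _

/-- For `n = 0` the truncated subtraction is harmless: only words with fewer than `k` letters are
present, and they stay so. -/
theorem shifted_mem (s : RTree) {k n : ℕ} {v : V} (hv : v ∈ wordSpan ρ w k n) :
    shifted ρ e s v ∈ wordSpan ρ w k (n - 1) := by
  induction hv using Submodule.span_induction with
  | mem v hv =>
    obtain ⟨l, hl, rfl⟩ := hv
    exact wordSpan_mono (by omega) (H.shifted_word_mem s l)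
  | zero => rw [map_zero]; exact zero_mem _
  | add v v' _ _ h h' => rw [map_add]; exact add_mem h h'
  | smul c v _ h => rw [map_smul]; exact Submodule.smul_mem _ c h

theorem shifted_mem_succ (s : RTree) {k n : ℕ} {v : V} (hv : v ∈ wordSpan ρ w k (n + 1)) :
    shifted ρ e s v ∈ wordSpan ρ w k n := by
  have h := H.shifted_mem s hv
  rwa [Nat.add_sub_cancel] at h

theorem shifted_mem_zero (s : RTree) {k : ℕ} {v : V} (hv : v ∈ wordSpan ρ w k 0) :
    shifted ρ e s v ∈ wordSpan ρ w k 0 := by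
  have h := H.shifted_mem s hv
  rwa [Nat.zero_sub] at h

theorem Dp_mem (s : RTree) {k : ℕ} {v : V} (hv : v ∈ wordSpan ρ w k 0) :
    ρ (Dp s) v ∈ wordSpan ρ w k 0 := by
  rw [Dp_eq_shifted (e := e)]
  exact add_mem (H.shifted_mem_zero s hv) (Submodule.smul_mem _ _ hv)

theorem exists_mem_wordSpan (v : V) : ∃ k, v ∈ wordSpan ρ w k 0 := by
  have hdir : Monotone fun k => wordSpan ρ w k 0 := fun k l h => wordSpan_mono (by omega)
  have h : (⨆ k, wordSpan ρ w k 0) = ⊤ := by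
    refine H.cyclic _ (Submodule.mem_iSup_of_mem 1 (word_mem (l := []) (by simp)))
      fun x v hv => ?_
    rw [Submodule.mem_iSup_of_directed _ hdir.directed_le] at hv
    obtain ⟨k, hv⟩ := hv
    refine Submodule.mem_iSup_of_mem (k + 1) ?_
    induction x using InsElimAlgebra.induct with
    | hb i =>
      rcases i with _ | t | t
      · exact lowering_mem' none hv
      · exact hdir k.le_succ (H.Dp_mem t hv)
      · exact lowering_mem' (some t) hv
    | h0 => simp
    | ha x y hx hy => rw [map_add, LinearMap.add_apply]; exact add_mem hx hy
    | hs c x hx => rw [map_smul, LinearMap.smul_apply]; exact Submodule.smul_mem _ _ hx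
  have hv : v ∈ ⨆ k, wordSpan ρ w k 0 := h ▸ Submodule.mem_top
  rwa [Submodule.mem_iSup_of_directed _ hdir.directed_le] at hv

/-- Every nonzero submodule contains a nonzero Whittaker vector. -/
theorem exists_whittaker {N : Submodule ℂ V} (hN : ∀ x, ∀ v ∈ N, ρ x v ∈ N) (h0 : N ≠ ⊥) :
    ∃ v ∈ N, v ≠ 0 ∧ ∀ t, ρ (Dp t) v = e t • v := by
  -- Lexicographic induction on `(k, n)`: a vector of `N` that is not Whittaker has a nonzero image
  -- under some `D_s^+ - e s`, which stays in `N` and lies strictly lower.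
  have key : ∀ k n, ∀ v ∈ wordSpan ρ w k n, v ∈ N → v ≠ 0 →
      ∃ v ∈ N, v ≠ 0 ∧ ∀ t, ρ (Dp t) v = e t • v := by
    intro k
    induction k with
    | zero =>
      intro n
      induction n with
      | zero =>
        intro v hv _ hv0
        rw [wordSpan_zero, Submodule.mem_bot] at hv
        exact absurd hv hv0
      | succ n ih =>
        intro v hv hvN hv0
        by_cases h : ∀ s, shifted ρ e s v = 0
        · exact ⟨v, hvN, hv0, fun t => sub_eq_zero.1 (h t)⟩
        · push Not at h
          obtain ⟨s, hs⟩ := h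
          exact ih _ (H.shifted_mem_succ s hv) (sub_mem (hN _ _ hvN) (N.smul_mem _ hvN)) hs
    | succ k ihk =>
      intro n
      induction n with
      | zero =>
        intro v hv
        obtain ⟨n, hn⟩ := exists_mem_wordSpan_of_succ hv
        exact ihk n v hn
      | succ n ih =>
        intro v hv hvN hv0
        by_cases h : ∀ s, shifted ρ e s v = 0
        · exact ⟨v, hvN, hv0, fun t => sub_eq_zero.1 (h t)⟩
        · push Not at h
          obtain ⟨s, hs⟩ := h
          exact ih _ (H.shifted_mem_succ s hv) (sub_mem (hN _ _ hvN) (N.smul_mem _ hvN)) hs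
  obtain ⟨v, hvN, hv0⟩ := (Submodule.ne_bot_iff N).1 h0
  obtain ⟨k, hk⟩ := H.exists_mem_wordSpan v
  exact key k 0 v hk hvN hv0

/-- Exchanging two adjacent letters costs their bracket, which is a combination of single letters.
Modulo shorter words the letters therefore commute, and leading terms can be treated as polynomials.
-/
theorem word_perm {l l' : List (Option RTree)} (h : l.Perm l') :
    word ρ w l - word ρ w l' ∈ wordSpan ρ w l.length 0 := by
  induction h with
  | nil => simp
  | cons y _ ih => rw [word, word, ← map_sub]; exact lowering_mem' y ih
  | swap y z l =>
    rw [word, word, word, word, ← H.lie]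
    exact lie_lowering_mem z y fun x => word_mem (l := x :: l) (by simp)
  | trans h₁ _ ih ih' =>
    rw [← h₁.length_eq] at ih'
    have := add_mem ih ih'
    rwa [sub_add_sub_cancel] at this

end IsCyclicWhittaker

end Words

theorem pderiv_mon (t : RTree) (c : Multiset RTree) :
    pderiv t (mon c) = (c.count t : ℂ) • mon (c.erase t) := by
  induction c using Multiset.induction with
  | empty => simp [mon]
  | cons a c ih =>
    rw [mon_cons, Derivation.leibniz, ih, smul_eq_mul, smul_eq_mul]
    by_cases h : a = t
    · subst h
      rw [MvPolynomial.pderiv_X_self, Multiset.count_cons_self, Multiset.erase_cons_head, mul_one,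
        mul_smul_comm, ← mon_cons, Nat.cast_add, Nat.cast_one, add_smul, one_smul]
      by_cases h : a ∈ c
      · rw [Multiset.cons_erase h]
      · simp [Multiset.count_eq_zero_of_notMem h]
    · rw [MvPolynomial.pderiv_X_of_ne h, mul_zero, add_zero, Multiset.count_cons_of_ne (Ne.symm h),
        Multiset.erase_cons_tail c h, mul_smul_comm, ← mon_cons]

theorem pderiv_ne_zero_of_mem_vars {t : RTree} {p : Poly} (h : t ∈ p.vars) : pderiv t p ≠ 0 := by
  obtain ⟨m, hm, ht⟩ := (MvPolynomial.mem_vars_iff_mem_support t).1 h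
  intro h0
  have hc : ∀ q : Poly, (pderiv t q).coeff (m - Finsupp.single t 1) = q.coeff m * m t := by
    intro q
    induction q using MvPolynomial.induction_on' with
    | monomial u a =>
      rw [MvPolynomial.pderiv_monomial, MvPolynomial.coeff_monomial, MvPolynomial.coeff_monomial]
      by_cases hu : u = m
      · subst hu; simp
      · rw [if_neg hu, zero_mul]
        split_ifs with h
        -- As `X_t` occurs in `m`, truncated subtraction can send distinct exponents `u` and `m` to
        -- the same value only when `X_t` does not occur in `u`.
        · have hut : u t = 0 := by
            by_contra hut
            refine hu (Finsupp.ext fun i => ?_)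
            have hi := DFunLike.congr_fun h i
            have := Finsupp.mem_support_iff.1 ht
            simp only [Finsupp.tsub_apply, Finsupp.single_apply] at hi
            split_ifs at hi with hti
            · subst hti; omega
            · omega
          rw [hut, Nat.cast_zero, mul_zero]
        · rfl
    | add p q hp hq => rw [map_add, MvPolynomial.coeff_add, hp, hq, MvPolynomial.coeff_add, add_mul]
  have := hc p
  rw [h0, MvPolynomial.coeff_zero] at this
  exact mul_ne_zero (MvPolynomial.mem_support_iff.1 hm)
    (Nat.cast_ne_zero.2 (Finsupp.mem_support_iff.1 ht)) this.symm

theorem pderiv_mem_degLT (t : RTree) {n : ℕ} {p : Poly} (hp : p ∈ degLT (n + 1)) :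
    pderiv t p ∈ degLT n := by
  induction hp using Submodule.span_induction with
  | mem p hp =>
    obtain ⟨i, hi, hp⟩ := hp
    rcases Nat.eq_zero_or_pos i with rfl | h
    · rw [MvPolynomial.totalDegree_eq_zero_iff_eq_C.1 (Nat.le_zero.1 hp.totalDegree_le)]
      simp
    · exact mem_degLT_of_isHomogeneous hp.pderiv (by omega)
  | zero => rw [map_zero]; exact zero_mem _
  | add p q _ _ hp hq => rw [map_add]; exact add_mem hp hq
  | smul a p _ hp => rw [Derivation.map_smul]; exact Submodule.smul_mem _ a hp

theorem degree_lt_of_mem_degLT {n : ℕ} {p : Poly} (hp : p ∈ degLT n) {m : RTree →₀ ℕ}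
    (hm : p.coeff m ≠ 0) : m.degree < n := by
  by_contra hn
  refine hm ?_
  clear hm
  induction hp using Submodule.span_induction with
  | mem p hp =>
    obtain ⟨i, hi, hp⟩ := hp
    by_contra h
    have := hp h
    change Finsupp.weight (fun _ => 1) m = i at this
    rw [← Finsupp.degree_eq_weight_one] at this
    omega
  | zero => simp
  | add p q _ _ hp hq => rw [MvPolynomial.coeff_add, hp, hq, add_zero]
  | smul a p _ hp => rw [MvPolynomial.coeff_smul, hp, smul_zero]

/-! ### Uniqueness when `e` is nonzero on arbitrarily large trees -/

section Words

variable {V : Type*} [AddCommGroup V] [Module ℂ V] (ρ : InsElimAlgebra →ₗ[ℂ] Module.End ℂ V)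
  (w : V)

/-- The list of lowering operators with the trees of a forest first, followed by `p` copies
of `d`. -/
noncomputable def normalList (c : Multiset RTree) (p : ℕ) : List (Option RTree) :=
  c.toList.map some ++ List.replicate p none

theorem coe_normalList (c : Multiset RTree) (p : ℕ) :
    (normalList c p : Multiset (Option RTree)) = c.map some + Multiset.replicate p none := by
  rw [normalList, ← Multiset.coe_add, ← Multiset.map_coe, Multiset.coe_toList,
    Multiset.coe_replicate]

theorem length_normalList (c : Multiset RTree) (p : ℕ) :
    (normalList c p).length = Multiset.card c + p := by simp [normalList]

theorem exists_perm_normalList (l : List (Option RTree)) : ∃ c p, l.Perm (normalList c p) := by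
  suffices ∃ c p, (l : Multiset (Option RTree)) = normalList c p by
    obtain ⟨c, p, h⟩ := this
    exact ⟨c, p, Multiset.coe_eq_coe.1 h⟩
  simp only [coe_normalList]
  induction l with
  | nil => exact ⟨0, 0, rfl⟩
  | cons y l ih =>
    obtain ⟨c, p, h⟩ := ih
    rcases y with _ | t
    · exact ⟨c, p + 1, by rw [← Multiset.cons_coe, h, Multiset.replicate_succ, Multiset.add_cons]⟩
    · exact ⟨t ::ₘ c, p, by rw [← Multiset.cons_coe, h, Multiset.map_cons, Multiset.cons_add]⟩

/-- The linear map sending the monomial of a forest `c` with at most `j` trees to the normal word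
given by `c` with `j` letters. -/
noncomputable def homogenize (j : ℕ) : Poly →ₗ[ℂ] V :=
  (MvPolynomial.basisMonomials RTree ℂ).constr ℂ fun m =>
    word ρ w (normalList (Finsupp.toMultiset m) (j - m.degree))

theorem homogenize_mon (j : ℕ) (c : Multiset RTree) :
    homogenize ρ w j (mon c) = word ρ w (normalList c (j - Multiset.card c)) := by
  rw [mon_eq_monomial, homogenize, (by simp : MvPolynomial.monomial (Multiset.toFinsupp c) (1 : ℂ) =
    MvPolynomial.basisMonomials RTree ℂ (Multiset.toFinsupp c)), Module.Basis.constr_basis,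
    ← card_toMultiset_eq_degree, Multiset.toFinsupp_toMultiset]

variable {ρ w} {e : RTree → ℂ}

namespace IsCyclicWhittaker

variable (H : IsCyclicWhittaker ρ e w)
include H

theorem Dp_Dm_mem (s t : RTree) (h : t.size ≤ s.size) (hst : t ≠ s) {k : ℕ} {v : V}
    (hv : v ∈ wordSpan ρ w k 0) :
    ∑ᶠ r, (alpha t s r : ℂ) • ρ (Dp r) v + ∑ᶠ r, (beta t s r : ℂ) • ρ (Dm r) v +
      (if t = s then ρ d v else 0) ∈ wordSpan ρ w k 0 := by
  rw [if_neg hst, add_zero]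
  refine add_mem (finsum_smul_mem fun r _ => H.Dp_mem r hv) (finsum_smul_mem fun r hr => ?_)
  have := size_of_beta_ne_zero (Nat.cast_ne_zero.1 hr)
  have := r.size_pos
  omega

/-- The size condition excludes all `β` terms, which require `|t| = |s| + |r|`, and the `α` terms
lose a letter. Only `[D_s^-, D_s^+] = d` survives in leading order, once for each occurrence of
`D_s^-`. -/
theorem shifted_word (s : RTree) (l : List (Option RTree)) (hl : ∀ t, some t ∈ l → t.size ≤ s.size) :
    shifted ρ e s (word ρ w l) + (l.count (some s) : ℂ) • word ρ w (none :: l.erase (some s)) ∈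
      wordSpan ρ w l.length 0 := by
  induction l with
  | nil => rw [word, H.shifted_w]; simp
  | cons y l ih =>
    have ih := ih fun t ht => hl t (List.mem_cons_of_mem _ ht)
    have hw : word ρ w l ∈ wordSpan ρ w (l.length + 1) 0 := word_mem (by omega)
    have h1 := lowering_mem' y ih
    rw [map_add, map_smul] at h1
    -- The new letter `d` is brought to the front, at the cost of shorter words. If `D_s^-` is
    -- absent the coefficient is zero, so the value of `erase` does not matter.
    have hperm : (l.count (some s) : ℂ) • (ρ (lowering y) (word ρ w (none :: l.erase (some s))) -
        word ρ w (none :: y :: l.erase (some s))) ∈ wordSpan ρ w (l.length + 1) 0 := by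
      by_cases h : some s ∈ l
      · refine Submodule.smul_mem _ _ ?_
        have := H.word_perm (List.Perm.swap none y (l.erase (some s)))
        rwa [List.length_cons, List.length_cons, List.length_erase_of_mem h,
          Nat.sub_add_cancel (List.length_pos_of_mem h)] at this
      · rw [List.count_eq_zero_of_not_mem h]; simp
    rw [word, List.length_cons]
    rcases y with _ | t
    · rw [List.count_cons_of_ne (by simp), List.erase_cons_tail (by simp), lowering, H.shifted_d]
      convert sub_mem (sub_mem h1 hperm) (Submodule.smul_mem _ (s.size : ℂ) (H.Dp_mem s hw)) using 1
      simp only [smul_sub, lowering]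
      abel
    · by_cases hts : t = s
      · subst hts
        rw [List.count_cons_self, List.erase_cons_head, lowering, H.shifted_Dm, if_pos rfl]
        have h2 : ∑ᶠ r, (alpha t t r : ℂ) • ρ (Dp r) (word ρ w l) +
            ∑ᶠ r, (beta t t r : ℂ) • ρ (Dm r) (word ρ w l) ∈ wordSpan ρ w (l.length + 1) 0 := by
          refine add_mem (finsum_smul_mem fun r _ => H.Dp_mem r hw) (finsum_smul_mem fun r hr => ?_)
          have := size_of_beta_ne_zero (Nat.cast_ne_zero.1 hr)
          have := r.size_pos
          omega
        have h3 : (l.count (some t) : ℂ) • word ρ w (none :: some t :: l.erase (some t)) -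
            (l.count (some t) : ℂ) • word ρ w (none :: l) ∈ wordSpan ρ w (l.length + 1) 0 := by
          by_cases h : some t ∈ l
          · rw [← smul_sub]
            refine Submodule.smul_mem _ _ ?_
            have := H.word_perm ((List.perm_cons_erase h).symm.cons none)
            rwa [List.length_cons, List.length_cons, List.length_erase_of_mem h,
              Nat.sub_add_cancel (List.length_pos_of_mem h)] at this
          · rw [List.count_eq_zero_of_not_mem h]; simp
        convert sub_mem (sub_mem (sub_mem h1 hperm) h2) h3 using 1
        simp only [smul_sub, lowering, Nat.cast_add, Nat.cast_one, add_smul, one_smul, word]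
        abel
      · have hne : some t ≠ some s := fun h => hts (Option.some.inj h)
        rw [List.count_cons_of_ne hne, List.erase_cons_tail (by simpa using hts), lowering,
          H.shifted_Dm]
        convert sub_mem (sub_mem h1 hperm) (H.Dp_Dm_mem s t (hl t List.mem_cons_self) hts hw) using 1
        simp only [smul_sub, lowering]
        abel

/-- Padding by `d` makes `d` the homogenizing variable: replacing `D_s^-` by `d` keeps `j` letters
and deletes one factor `X_s`. Thus `D_s^+ - e s` has leading symbol `-∂/∂X_s`. -/
theorem shifted_homogenize_mon (s : RTree) {j : ℕ} {c : Multiset RTree} (hc : Multiset.card c ≤ j)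
    (hs : ∀ t ∈ c, t.size ≤ s.size) :
    shifted ρ e s (homogenize ρ w j (mon c)) + homogenize ρ w j (pderiv s (mon c)) ∈
      wordSpan ρ w j 0 := by
  rw [pderiv_mon, map_smul, homogenize_mon, homogenize_mon]
  have h := H.shifted_word s (normalList c (j - Multiset.card c)) fun t ht => hs t (by
    rw [← Multiset.mem_coe, coe_normalList] at ht
    simpa [Multiset.mem_replicate] using ht)
  have hcount : (normalList c (j - Multiset.card c)).count (some s) = c.count s := by
    rw [lawful_beq_subsingleton Option.instBEq instBEqOfDecidableEq, ← Multiset.coe_count, coe_normalList,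
      Multiset.count_add,
      Multiset.count_map_eq_count' _ _ (Option.some_injective _), Multiset.count_replicate]
    simp
  rw [hcount, length_normalList, Nat.add_sub_cancel' hc] at h
  by_cases hsc : s ∈ c
  · have hpos := Multiset.card_pos_iff_exists_mem.2 ⟨s, hsc⟩
    have hperm : (none :: (normalList c (j - Multiset.card c)).erase (some s)).Perm
        (normalList (c.erase s) (j - Multiset.card (c.erase s))) := by
      rw [lawful_beq_subsingleton Option.instBEq instBEqOfDecidableEq, ← Multiset.coe_eq_coe, ← Multiset.cons_coe,
        ← Multiset.coe_erase, coe_normalList,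
        coe_normalList, Multiset.card_erase_of_mem hsc, Multiset.map_erase _ (Option.some_injective _),
        Multiset.erase_add_left_pos _ (Multiset.mem_map_of_mem _ hsc),
        show j - (Multiset.card c).pred = j - Multiset.card c + 1 by
          rw [Nat.pred_eq_sub_one]; omega, Multiset.replicate_succ, Multiset.add_cons]
    have h2 := H.word_perm hperm
    rw [hperm.length_eq, length_normalList, Multiset.card_erase_of_mem hsc, Nat.pred_eq_sub_one,
      show Multiset.card c - 1 + (j - (Multiset.card c - 1)) = j by omega] at h2
    convert sub_mem h (Submodule.smul_mem _ (c.count s : ℂ) h2) using 1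
    rw [smul_sub, Multiset.card_erase_of_mem hsc, Nat.pred_eq_sub_one]; abel
  · rw [Multiset.count_eq_zero_of_notMem hsc] at h ⊢
    simpa using h

theorem shifted_homogenize (s : RTree) {j : ℕ} {p : Poly} (hp : p ∈ degLT (j + 1))
    (hs : ∀ t ∈ p.vars, t.size ≤ s.size) :
    shifted ρ e s (homogenize ρ w j p) + homogenize ρ w j (pderiv s p) ∈ wordSpan ρ w j 0 := by
  have h : ∀ m ∈ p.support, (shifted ρ e s ∘ₗ homogenize ρ w j + homogenize ρ w j ∘ₗ
      (pderiv s).toLinearMap) (monomial m (p.coeff m)) ∈ wordSpan ρ w j 0 := by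
    intro m hm
    rw [monomial_eq_smul_mon, map_smul]
    refine Submodule.smul_mem _ _ (H.shifted_homogenize_mon s ?_ fun t ht => hs t ?_)
    · rw [card_toMultiset_eq_degree]
      exact Nat.lt_succ_iff.1 (degree_lt_of_mem_degLT hp (MvPolynomial.mem_support_iff.1 hm))
    · rw [Finsupp.mem_toMultiset] at ht
      exact (MvPolynomial.mem_vars_iff_mem_support t).2 ⟨m, hm, by simpa using ht⟩
  have := sum_mem h
  rwa [← _root_.map_sum, p.support_sum_monomial_coeff] at this

omit H in
theorem homogenize_C (j : ℕ) (a : ℂ) :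
    homogenize ρ w j (C a) = a • word ρ w (normalList 0 j) := by
  rw [MvPolynomial.C_eq_smul_one, map_smul, ← mon_zero, homogenize_mon, Multiset.card_zero,
    Nat.sub_zero]

/-- If `p` is not constant, let `t` be a largest tree among its variables. The symbol formula places
the word of `∂p/∂X_t` in lower order, so by induction this derivative is a constant; it is zero
because `d^j w` is not of lower order. This contradicts the occurrence of `X_t`. -/
theorem eq_C_of_shifted_homogenize_mem {j : ℕ} (hj : word ρ w (normalList 0 j) ∉ wordSpan ρ w j 0)
    {n : ℕ} (hn : n ≤ j + 1) {p : Poly} (hp : p ∈ degLT n)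
    (hs : ∀ s, shifted ρ e s (homogenize ρ w j p) ∈ wordSpan ρ w j 0) : ∃ a, p = C a := by
  induction n generalizing p with
  | zero =>
    refine ⟨0, MvPolynomial.ext _ _ fun m => ?_⟩
    by_contra h
    have := degree_lt_of_mem_degLT hp (m := m) (by simpa using h)
    omega
  | succ n ih =>
    rcases p.vars.eq_empty_or_nonempty with h0 | h0
    · exact ⟨_, MvPolynomial.vars_eq_empty_iff_eq_C.1 h0⟩
    · obtain ⟨t, ht, hmax⟩ := p.vars.exists_max_image size h0
      have h1 := sub_mem (H.shifted_homogenize t (degLT_mono hn hp) hmax) (hs t)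
      rw [add_sub_cancel_left] at h1
      obtain ⟨a, ha⟩ := ih (by omega) (pderiv_mem_degLT t hp) fun s => H.shifted_mem_zero s h1
      rw [ha, homogenize_C] at h1
      have ha0 : a = 0 := by
        by_contra h
        exact hj ((Submodule.smul_mem_iff _ h).1 h1)
      exact absurd (by rw [ha, ha0, map_zero]) (pderiv_ne_zero_of_mem_vars ht)

theorem exists_homogenize {j : ℕ} {v : V} (hv : v ∈ wordSpan ρ w (j + 1) 0) :
    ∃ p ∈ degLT (j + 1), v - homogenize ρ w j p ∈ wordSpan ρ w j 0 := by
  induction hv using Submodule.span_induction with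
  | mem v hv =>
    obtain ⟨l, hl, rfl⟩ := hv
    rcases Nat.lt_or_ge l.length j with h | h
    · exact ⟨0, zero_mem _, by rw [map_zero, sub_zero]; exact word_mem (Or.inl h)⟩
    · obtain ⟨c, p, hp⟩ := exists_perm_normalList l
      have h1 := hp.length_eq
      rw [length_normalList] at h1
      refine ⟨mon c, mem_degLT_of_isHomogeneous (isHomogeneous_mon c) (by omega), ?_⟩
      have h2 := H.word_perm hp
      rwa [homogenize_mon, show j - Multiset.card c = p by omega, show j = l.length by omega]
  | zero => exact ⟨0, zero_mem _, by simp⟩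
  | add v v' _ _ h h' =>
    obtain ⟨p, hp, h⟩ := h
    obtain ⟨p', hp', h'⟩ := h'
    exact ⟨p + p', add_mem hp hp', by rw [map_add, add_sub_add_comm]; exact add_mem h h'⟩
  | smul a v _ h =>
    obtain ⟨p, hp, h⟩ := h
    exact ⟨a • p, Submodule.smul_mem _ a hp, by
      rw [map_smul, ← smul_sub]; exact Submodule.smul_mem _ a h⟩

/-- Each passage of `D_s^+` through one of the `j + 1` factors `d` contributes `-|s| D_s^+`, whose
leading part on a shorter word is the scalar `e s`. -/
theorem shifted_d_pow (s : RTree) (j : ℕ) :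
    shifted ρ e s (word ρ w (normalList 0 (j + 1))) +
      (((j + 1 : ℕ) : ℂ) * s.size * e s) • word ρ w (normalList 0 j) ∈ wordSpan ρ w j 0 := by
  have hsucc : ∀ j, word ρ w (normalList 0 (j + 1)) = ρ d (word ρ w (normalList 0 j)) := fun j => by
    simp [normalList, List.replicate_succ, word, lowering]
  induction j with
  | zero =>
    rw [hsucc, show word ρ w (normalList 0 0) = w by simp [normalList, word], H.shifted_d,
      H.shifted_w, H.whittaker, map_zero, zero_sub, smul_smul]
    simp
  | succ j ih =>
    have h1 := lowering_mem' none ih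
    rw [lowering, map_add, map_smul, ← hsucc] at h1
    have h2 : word ρ w (normalList 0 j) ∈ wordSpan ρ w (j + 1) 0 :=
      word_mem (Or.inl (by simp [length_normalList]))
    have h3 : shifted ρ e s (word ρ w (normalList 0 (j + 1))) ∈ wordSpan ρ w (j + 1) 0 := by
      have := sub_mem (wordSpan_mono (Or.inl j.lt_succ_self) ih)
        (Submodule.smul_mem _ (((j + 1 : ℕ) : ℂ) * s.size * e s) h2)
      rwa [add_sub_cancel_right] at this
    convert sub_mem h1 (Submodule.smul_mem _ (s.size : ℂ) h3) using 1
    rw [hsucc (j + 1), H.shifted_d, Dp_eq_shifted (e := e), Nat.cast_add (j + 1), Nat.cast_one]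
    module

/-- A tree `s` larger than every tree occurring cannot be a letter, so the leading term of
`shifted_word` has coefficient zero and a letter is lost. -/
theorem shifted_mem_of_large {k : ℕ} {v : V} (hv : v ∈ wordSpan ρ w (k + 1) 0) :
    ∃ n, ∀ s : RTree, n < s.size → shifted ρ e s v ∈ wordSpan ρ w k 0 := by
  induction hv using Submodule.span_induction with
  | mem v hv =>
    obtain ⟨l, hl, rfl⟩ := hv
    refine ⟨wsize l, fun s hs => ?_⟩
    have hlt : ∀ t, some t ∈ l → t.size < s.size := fun t ht =>
      (List.single_le_sum (by simp) _ (List.mem_map_of_mem (f := lsize) ht)).trans_lt hs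
    have h := H.shifted_word s l fun t ht => (hlt t ht).le
    rw [List.count_eq_zero_of_not_mem fun h => (hlt s h).ne rfl, Nat.cast_zero, zero_smul,
      add_zero] at h
    have hle : wordSpan ρ w l.length 0 ≤ wordSpan ρ w k 0 := wordSpan_mono (by omega)
    exact hle h
  | zero => exact ⟨0, fun s _ => by rw [map_zero]; exact zero_mem _⟩
  | add v v' _ _ h h' =>
    obtain ⟨n, h⟩ := h
    obtain ⟨n', h'⟩ := h'
    exact ⟨n + n', fun s hs => by
      rw [map_add]; exact add_mem (h s (by omega)) (h' s (by omega))⟩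
  | smul a v _ h =>
    obtain ⟨n, h⟩ := h
    exact ⟨n, fun s hs => by rw [map_smul]; exact Submodule.smul_mem _ a (h s hs)⟩

/-- Were `d^(j+1) w` a combination of shorter words, a large `s` with `e s ≠ 0` would lower both
sides, and `shifted_d_pow` would express `d^j w` through words with fewer than `j` letters. The
induction starts from `w ≠ 0`. -/
theorem d_pow_notMem (he : ∀ n, ∃ s : RTree, n < s.size ∧ e s ≠ 0) (j : ℕ) :
    word ρ w (normalList 0 j) ∉ wordSpan ρ w j 0 := by
  induction j with
  | zero =>
    rw [wordSpan_zero, Submodule.mem_bot]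
    simpa [normalList, word] using H.ne_zero
  | succ j ih =>
    intro h
    obtain ⟨n, hn⟩ := H.shifted_mem_of_large h
    obtain ⟨s, hs, hes⟩ := he n
    have h1 := sub_mem (H.shifted_d_pow s j) (hn s hs)
    rw [add_sub_cancel_left] at h1
    refine ih ((Submodule.smul_mem_iff _ ?_).1 h1)
    exact mul_ne_zero (mul_ne_zero (Nat.cast_ne_zero.2 j.succ_ne_zero)
      (Nat.cast_ne_zero.2 s.size_pos.ne')) hes

/-- Whittaker vectors are unique up to scalars if `e` has unbounded support. -/
theorem eq_smul_of_unbounded (he : ∀ n, ∃ s : RTree, n < s.size ∧ e s ≠ 0) {v : V}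
    (hv : ∀ s, shifted ρ e s v = 0) : ∃ a : ℂ, v = a • w := by
  obtain ⟨k, hk⟩ := H.exists_mem_wordSpan v
  induction k with
  | zero =>
    rw [wordSpan_zero, Submodule.mem_bot] at hk
    exact ⟨0, by rw [hk, zero_smul]⟩
  | succ j ih =>
    obtain ⟨p, hp, hvp⟩ := H.exists_homogenize hk
    obtain ⟨a, rfl⟩ := H.eq_C_of_shifted_homogenize_mem (H.d_pow_notMem he j) le_rfl hp fun s => by
      have := H.shifted_mem_zero s hvp
      rw [map_sub, hv, zero_sub] at this
      exact (Submodule.neg_mem_iff _).1 this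
    rw [homogenize_C] at hvp
    rcases j with _ | j
    · rw [wordSpan_zero, Submodule.mem_bot, sub_eq_zero] at hvp
      exact ⟨a, by simpa [normalList, word] using hvp⟩
    -- Here `v` equals `a d^(j+1) w` up to shorter words. Since `v` is killed, a large `s` with `e s
    -- ≠ 0` puts a multiple of `d^j w`, nonzero unless `a = 0`, among words with fewer than `j`
    -- letters.
    · obtain ⟨n, hn⟩ := H.shifted_mem_of_large hvp
      obtain ⟨s, hs, hes⟩ := he n
      have h1 := add_mem (hn s hs) (Submodule.smul_mem _ a (H.shifted_d_pow s j))
      rw [map_sub, hv, map_smul, smul_add, zero_sub, neg_add_cancel_left, smul_smul] at h1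
      by_cases ha : a = 0
      · rw [ha, zero_smul, sub_zero] at hvp
        exact ih hvp
      · refine absurd ((Submodule.smul_mem_iff _ ?_).1 h1) (H.d_pow_notMem he j)
        exact mul_ne_zero ha (mul_ne_zero (mul_ne_zero (Nat.cast_ne_zero.2 j.succ_ne_zero)
          (Nat.cast_ne_zero.2 s.size_pos.ne')) hes)

end IsCyclicWhittaker

end Words

/-- The total number of vertices of a forest. -/
def weight (c : Multiset RTree) : ℕ := (c.map size).sum

theorem weight_cons (t : RTree) (c : Multiset RTree) : weight (t ::ₘ c) = t.size + weight c := by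
  simp [weight]

theorem weight_add (c c' : Multiset RTree) : weight (c + c') = weight c + weight c' := by
  simp [weight]

theorem card_le_weight (c : Multiset RTree) : Multiset.card c ≤ weight c := by
  induction c using Multiset.induction with
  | empty => simp
  | cons t c ih =>
    have := t.size_pos
    rw [weight_cons, Multiset.card_cons]; omega

theorem map_finsum_smul {V W : Type*} [AddCommGroup V] [Module ℂ V] [AddCommGroup W] [Module ℂ W]
    (φ : V →ₗ[ℂ] W) {c : RTree → ℕ} (hc : {r | c r ≠ 0}.Finite) (f : RTree → V) :
    φ (∑ᶠ r, (c r : ℂ) • f r) = ∑ᶠ r, (c r : ℂ) • φ (f r) := by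
  rw [map_finsum φ (finite_smul (cast_finite hc) f)]
  simp

/-- A left inverse of `plant`. -/
noncomputable def unplant : Poly →ₗ[ℂ] Poly :=
  (MvPolynomial.basisMonomials RTree ℂ).constr ℂ fun m =>
    mon ((Finsupp.toMultiset m).map components).sum

theorem unplant_X (t : RTree) : unplant (X t) = mon t.components := by
  rw [show (X t : Poly) = MvPolynomial.basisMonomials RTree ℂ (Finsupp.single t 1) by simp [X],
    unplant, Module.Basis.constr_basis]
  simp

theorem unplant_plant (p : Poly) : unplant (plant p) = p := by
  have : unplant ∘ₗ plant = LinearMap.id := poly_ext fun c => by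
    rw [LinearMap.comp_apply, plant_mon, unplant_X, components_node]; rfl
  exact LinearMap.congr_fun this p

theorem tot_Dm (t : RTree) : tot (Dm t) = pderiv t + derMinus t := by
  rw [tot, LinearMap.add_apply, pd_Dm, der_Dm]

/-- An edge of `s` either joins the root to a component, and cutting it removes that component (the
term `∂/∂X_t`), or lies inside a component (the term `derMinus t`). This turns the `α` terms of a
commutator into an operator on forests. -/
theorem tot_Dm_mon_components (t s : RTree) :
    tot (Dm t) (mon s.components) = ∑ᶠ r, (alpha t s r : ℂ) • mon r.components := by
  have h := der_plant (Dm t) (mon s.components)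
  rw [plant_mon, node_components, pol_Dm, zero_mul, zero_add, der_Dm, derMinus_X] at h
  have h := congrArg unplant h
  rw [unplant_plant, map_finsum_smul unplant (finite_alpha t s)] at h
  simpa only [unplant_X] using h.symm

/-- The product of the factorials of the multiplicities of a forest. -/
noncomputable def multFactorial (c : Multiset RTree) : ℂ := ∏ t ∈ c.toFinset, ((c.count t).factorial : ℂ)

theorem multFactorial_ne_zero (c : Multiset RTree) : multFactorial c ≠ 0 :=
  Finset.prod_ne_zero_iff.2 fun _ _ => Nat.cast_ne_zero.2 (Nat.factorial_ne_zero _)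

theorem multFactorial_cons (t : RTree) (c : Multiset RTree) :
    multFactorial (t ::ₘ c) = ((c.count t + 1 : ℕ) : ℂ) * multFactorial c := by
  have h : multFactorial c = ∏ x ∈ (t ::ₘ c).toFinset, ((c.count x).factorial : ℂ) := by
    refine Finset.prod_subset (fun x hx => ?_) fun x _ hx => ?_
    · rw [Multiset.mem_toFinset] at hx ⊢; exact Multiset.mem_cons_of_mem hx
    · rw [Multiset.mem_toFinset] at hx
      rw [Multiset.count_eq_zero_of_notMem hx]; simp
  have ht : t ∈ (t ::ₘ c).toFinset := Multiset.mem_toFinset.2 (Multiset.mem_cons_self _ _)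
  rw [h, multFactorial, ← Finset.mul_prod_erase _ _ ht, ← Finset.mul_prod_erase _ _ ht,
    Multiset.count_cons_self, Nat.factorial_succ, Nat.cast_mul, mul_assoc]
  congr 2
  refine Finset.prod_congr rfl fun x hx => ?_
  rw [Multiset.count_cons_of_ne (Finset.ne_of_mem_erase hx)]

/-! ### Cutting operators on functionals of forests -/

section Trim

variable (g : Multiset RTree → ℂ)

/-- The functional on polynomials obtained from a function `g` on forests by composing with the
operators `-D_t^-`, for `t` in a list. -/
noncomputable def trim : List RTree → Poly →ₗ[ℂ] ℂ
  | [] => (MvPolynomial.basisMonomials RTree ℂ).constr ℂ fun m => g (Finsupp.toMultiset m)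
  | t :: l => -(trim l ∘ₗ (tot (Dm t)).toLinearMap)

theorem trim_nil_mon (c : Multiset RTree) : trim g [] (mon c) = g c := by
  rw [mon_eq_monomial, trim, (by simp : MvPolynomial.monomial (Multiset.toFinsupp c) (1 : ℂ) =
    MvPolynomial.basisMonomials RTree ℂ (Multiset.toFinsupp c)), Module.Basis.constr_basis,
    Multiset.toFinsupp_toMultiset]

theorem trim_cons (t : RTree) (l : List RTree) (p : Poly) :
    trim g (t :: l) p = -trim g l (tot (Dm t) p) := rfl

variable {g} {f : ℕ} (hf : ∀ c, f < Multiset.card c → g c = 0)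
include hf

/-- Each operator removes at most one tree: `∂/∂X_t` removes one and `derMinus t` none. So more than
`f` trees are left when `g` is evaluated. -/
theorem trim_eq_zero (l : List RTree) {n : ℕ} (hn : l.length + f < n) {p : Poly}
    (hp : p.IsHomogeneous n) : trim g l p = 0 := by
  induction l generalizing n p with
  | nil =>
    refine homogeneous_induction (n := n) (motive := fun p => trim g [] p = 0)
      (fun c hc => ?_) (map_zero _) (fun p q hp hq => ?_) (fun a p hp => ?_) hp
    · rw [trim_nil_mon, hf c (by simpa [hc] using hn)]
    · rw [map_add, hp, hq, add_zero]
    · rw [map_smul, hp, smul_zero]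
  | cons t l ih =>
    rw [List.length_cons] at hn
    rw [trim_cons, tot_Dm, Derivation.add_apply, map_add,
      ih (n := n - 1) (by omega) hp.pderiv, ih (n := n) (by omega) (isHomogeneous_derMinus t hp)]
    simp

/-- In the critical degree `l.length + f`, a single use of `derMinus` would leave too many trees.
Only iterated partial derivatives contribute, which accounts for the factorials. -/
theorem trim_mon_add (l : List RTree) {c : Multiset RTree} (hc : Multiset.card c = f) :
    trim g l (mon (l + c)) * multFactorial c = (-1) ^ l.length * multFactorial (l + c) * g c := by
  induction l with
  | nil =>
    rw [Multiset.coe_nil, zero_add, trim_nil_mon]; simp [mul_comm]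
  | cons t l ih =>
    rw [trim_cons, tot_Dm, Derivation.add_apply, map_add, trim_eq_zero hf l (n := l.length + 1 + f)
      (by omega) (isHomogeneous_derMinus t ?_), ← Multiset.cons_coe, Multiset.cons_add, pderiv_mon,
      Multiset.count_cons_self, Multiset.erase_cons_head, map_smul, smul_eq_mul, add_zero,
      multFactorial_cons, neg_mul, mul_assoc, ih, List.length_cons]
    · ring
    · convert isHomogeneous_mon _ using 1
      simp [hc]

theorem trim_mon_of_not_le (l : List RTree) {b : Multiset RTree}
    (hb : Multiset.card b = l.length + f) (h : ¬ (l : Multiset RTree) ≤ b) :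
    trim g l (mon b) = 0 := by
  induction l generalizing b with
  | nil => exact absurd (Multiset.zero_le b) h
  | cons t l ih =>
    rw [List.length_cons] at hb
    rw [trim_cons, tot_Dm, Derivation.add_apply, map_add, trim_eq_zero hf l (n := Multiset.card b)
      (by omega) (isHomogeneous_derMinus t (isHomogeneous_mon b)), pderiv_mon, map_smul, add_zero]
    by_cases ht : t ∈ b
    · obtain ⟨b, rfl⟩ := Multiset.exists_cons_of_mem ht
      rw [← Multiset.cons_coe, Multiset.cons_le_cons_iff] at h
      rw [Multiset.card_cons] at hb
      rw [Multiset.erase_cons_head, ih (by omega) h, smul_zero, neg_zero]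
    · rw [Multiset.count_eq_zero_of_notMem ht]; simp

end Trim

theorem toFinsupp_le_iff {c b : Multiset RTree} :
    Multiset.toFinsupp c ≤ Multiset.toFinsupp b ↔ c ≤ b := by
  rw [Multiset.le_iff_count, Finsupp.le_def]
  simp only [Multiset.toFinsupp_apply]

/-- Nonzero combinations of products of the lowering operators `D_t^-` do not annihilate nonzero
functionals on forests. -/
theorem exists_sum_trim_ne_zero {R N : ℕ} {g : Multiset RTree → ℂ}
    (hg : ∀ c, g c ≠ 0 → 1 + weight c = R) (hg0 : ∃ c, g c ≠ 0) (S : Finset (Multiset RTree))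
    (hS : ∀ c ∈ S, weight c = N) (q : Multiset RTree → ℂ) (hq : ∃ c ∈ S, q c ≠ 0) :
    ∃ b, 1 + weight b = N + R ∧ ∑ c ∈ S, q c * trim g c.toList (mon b) ≠ 0 := by
  have hbdd : ∀ c, g c ≠ 0 → Multiset.card c ≤ R := fun c hc => by
    have := hg c hc
    have := card_le_weight c
    omega
  obtain ⟨f, ⟨c₀, hc₀, hc₀f⟩, hfmax⟩ : ∃ f, (∃ c, g c ≠ 0 ∧ Multiset.card c = f) ∧
      ∀ c, f < Multiset.card c → g c = 0 := by
    have hP : ∃ n ≤ R, ∃ c, g c ≠ 0 ∧ Multiset.card c = n := by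
      obtain ⟨c, hc⟩ := hg0
      exact ⟨_, hbdd c hc, c, hc, rfl⟩
    classical
    refine ⟨Nat.findGreatest (fun n => ∃ c, g c ≠ 0 ∧ Multiset.card c = n) R, ?_, fun c hc => ?_⟩
    · obtain ⟨n, hn, hP⟩ := hP
      exact Nat.findGreatest_spec (P := fun n => ∃ c, g c ≠ 0 ∧ Multiset.card c = n) hn hP
    · by_contra h
      exact Nat.findGreatest_is_greatest hc (hbdd c h) ⟨c, h, rfl⟩
  obtain ⟨c₁, hc₁, hmax⟩ := (S.filter fun c => q c ≠ 0).exists_max_image Multiset.card (by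
    obtain ⟨c, hc, hqc⟩ := hq
    exact ⟨c, Finset.mem_filter.2 ⟨hc, hqc⟩⟩)
  rw [Finset.mem_filter] at hc₁
  set m := Multiset.card c₁ with hm
  set S' := S.filter fun c => Multiset.card c = m with hS'
  -- Leading parts: `Q` collects the forests with the maximal number `m` of trees, and `G` the part
  -- of `g` on forests of `f` trees divided by multiplicity factorials. With this normalization,
  -- transposed derivatives become multiplication. Power series avoid any finiteness condition on
  -- `G`.
  let Q : MvPowerSeries RTree ℂ :=
    ∑ c ∈ S', MvPowerSeries.monomial (Multiset.toFinsupp c) ((-1) ^ m * q c)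
  let G : MvPowerSeries RTree ℂ := fun n => if n.degree = f then
    g (Finsupp.toMultiset n) / multFactorial (Finsupp.toMultiset n) else 0
  have hGcoeff : ∀ c, MvPowerSeries.coeff (Multiset.toFinsupp c) G =
      if Multiset.card c = f then g c / multFactorial c else 0 := by
    intro c
    change (if (Multiset.toFinsupp c).degree = f then _ else _) = _
    rw [← card_toMultiset_eq_degree, Multiset.toFinsupp_toMultiset]
  have hQ0 : Q ≠ 0 := by
    intro h
    have h1 := congrArg (MvPowerSeries.coeff (Multiset.toFinsupp c₁)) h
    simp only [Q] at h1
    rw [_root_.map_sum, Finset.sum_eq_single c₁, MvPowerSeries.coeff_monomial_same, map_zero] at h1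
    · exact mul_ne_zero (pow_ne_zero _ (by norm_num)) hc₁.2 h1
    · intro c _ hc
      exact MvPowerSeries.coeff_monomial_ne (fun h => hc (Multiset.toFinsupp.injective h).symm) _
    · intro h
      exact absurd (Finset.mem_filter.2 ⟨hc₁.1, hm.symm⟩) h
  have hG0 : G ≠ 0 := by
    intro h
    have h1 := hGcoeff c₀
    rw [h, if_pos hc₀f, map_zero] at h1
    exact div_ne_zero hc₀ (multFactorial_ne_zero _) h1.symm
  -- The power series ring is a domain; a monomial with nonzero coefficient in the product is the
  -- required forest `b`.
  have hQG : Q * G ≠ 0 := mul_ne_zero hQ0 hG0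
  obtain ⟨n, hn⟩ : ∃ n, MvPowerSeries.coeff n (Q * G) ≠ 0 := by
    by_contra! h
    exact hQG (MvPowerSeries.ext fun n => by rw [h n, map_zero])
  obtain ⟨b, rfl⟩ := Multiset.toFinsupp.surjective n
  have hexp : MvPowerSeries.coeff (Multiset.toFinsupp b) (Q * G) = ∑ c ∈ S',
      MvPowerSeries.coeff (Multiset.toFinsupp b)
        (MvPowerSeries.monomial (Multiset.toFinsupp c) ((-1) ^ m * q c) * G) := by
    rw [Finset.sum_mul, _root_.map_sum]
  rw [hexp] at hn
  have hb : 1 + weight b = N + R ∧ Multiset.card b = m + f := by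
    obtain ⟨c, hc, hcb⟩ := Finset.exists_ne_zero_of_sum_ne_zero hn
    rw [Finset.mem_filter] at hc
    have hle : c ≤ b := by
      by_contra h
      rw [MvPowerSeries.coeff_monomial_mul, if_neg (fun h' => h (toFinsupp_le_iff.1 h'))] at hcb
      exact hcb rfl
    obtain ⟨c', rfl⟩ := Multiset.le_iff_exists_add.1 hle
    rw [map_add, MvPowerSeries.coeff_add_monomial_mul, hGcoeff] at hcb
    split_ifs at hcb with hcf
    · have := hg c' fun h => hcb (by rw [h, zero_div, mul_zero])
      rw [weight_add, hS c hc.1, Multiset.card_add, hc.2, hcf]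
      omega
    · exact absurd (mul_zero _) hcb
  refine ⟨b, hb.1, ?_⟩
  -- On a forest of `m + f` trees the lists with fewer than `m` letters contribute zero, and the
  -- others give a coefficient of `Q * G` up to the factorial of `b`.
  have hsum : ∑ c ∈ S, q c * trim g c.toList (mon b) = multFactorial b * ∑ c ∈ S',
      MvPowerSeries.coeff (Multiset.toFinsupp b)
        (MvPowerSeries.monomial (Multiset.toFinsupp c) ((-1) ^ m * q c) * G) := by
    rw [Finset.mul_sum, hS', Finset.sum_filter]
    refine Finset.sum_congr rfl fun c hc => ?_
    split_ifs with hcm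
    · by_cases hle : c ≤ b
      · obtain ⟨c', rfl⟩ := Multiset.le_iff_exists_add.1 hle
        have hcard : Multiset.card c' = f := by
          have := hb.2
          rw [Multiset.card_add, hcm] at this
          omega
        have h := trim_mon_add hfmax c.toList hcard
        rw [Multiset.coe_toList, Multiset.length_toList, hcm] at h
        rw [map_add, MvPowerSeries.coeff_add_monomial_mul, hGcoeff, if_pos hcard,
          eq_div_of_mul_eq (multFactorial_ne_zero _) h]
        ring
      · rw [MvPowerSeries.coeff_monomial_mul, if_neg (fun h' => hle (toFinsupp_le_iff.1 h')),
          trim_mon_of_not_le hfmax _ (by rw [hb.2, Multiset.length_toList, hcm])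
            (by rwa [Multiset.coe_toList]), mul_zero, mul_zero]
    · by_cases hqc : q c = 0
      · rw [hqc, zero_mul]
      · have := hmax c (Finset.mem_filter.2 ⟨hc, hqc⟩)
        rw [trim_eq_zero hfmax c.toList (n := m + f) (by rw [Multiset.length_toList]; omega)
          (hb.2 ▸ isHomogeneous_mon b), mul_zero]
  rw [hsum]
  exact mul_ne_zero (multFactorial_ne_zero _) hn

/-- Iterating the translation shows that `q` takes the value `q(0)` at the infinitely many points
`-kn`. -/
theorem eq_C_of_comp_sub_eq {q : Polynomial ℂ} {n : ℂ} (hn : n ≠ 0)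
    (h : q.comp (Polynomial.X - Polynomial.C n) = q) : ∃ a, q = Polynomial.C a := by
  have h1 : ∀ k : ℕ, q.eval (-(k * n)) = q.eval 0 := by
    intro k
    induction k with
    | zero => simp
    | succ k ih =>
      rw [← ih]
      conv_rhs => rw [← h]
      rw [Polynomial.eval_comp]
      congr 1
      simp
      ring
  refine ⟨q.eval 0, Polynomial.eq_of_infinite_eval_eq _ _ ?_⟩
  refine Set.infinite_of_injective_forall_mem (f := fun k : ℕ => -((k : ℂ) * n)) ?_ fun k => ?_
  · intro k l hkl
    simpa [hn] using hkl
  · change Polynomial.eval _ _ = Polynomial.eval _ _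
    rw [h1, Polynomial.eval_C]

/-! ### Uniqueness when the support of `e` has bounded size -/

section Words

variable {V : Type*} [AddCommGroup V] [Module ℂ V] {ρ : InsElimAlgebra →ₗ[ℂ] Module.End ℂ V}
  {e : RTree → ℂ} {w : V}

theorem word_append (l l' : List (Option RTree)) :
    word ρ w (l ++ l') = word ρ (word ρ w l') l := by
  induction l with
  | nil => rfl
  | cons y l ih => rw [List.cons_append, word, ih, word]

theorem word_replicate (p : ℕ) : word ρ w (List.replicate p none) = (ρ d ^ p) w := by
  induction p with
  | zero => rfl
  | succ p ih => rw [List.replicate_succ, word, ih, pow_succ']; rfl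

theorem word_normalList (c : Multiset RTree) (p : ℕ) :
    word ρ w (normalList c p) = word ρ ((ρ d ^ p) w) (c.toList.map some) := by
  rw [normalList, word_append, word_replicate]

theorem finsum_beta_eq_zero {s t : RTree} (h : t.size ≤ s.size) (v : V) :
    ∑ᶠ r, (beta t s r : ℂ) • ρ (Dm r) v = 0 := by
  refine finsum_eq_zero_of_forall_eq_zero fun r => ?_
  by_cases hr : beta t s r = 0
  · rw [hr, Nat.cast_zero, zero_smul]
  · have := size_of_beta_ne_zero hr
    have := r.size_pos
    omega

namespace IsCyclicWhittaker

variable (H : IsCyclicWhittaker ρ e w)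
include H

theorem Dp_aeval (s : RTree) (q : Polynomial ℂ) (v : V) :
    ρ (Dp s) (Polynomial.aeval (ρ d) q v) =
      Polynomial.aeval (ρ d) (q.comp (Polynomial.X - Polynomial.C (s.size : ℂ))) (ρ (Dp s) v) := by
  induction q using Polynomial.induction_on' with
  | add p q hp hq => simp [hp, hq]
  | monomial n a =>
    induction n generalizing a with
    | zero => simp
    | succ n ih =>
      have h1 := ih 1
      rw [← Polynomial.C_mul_X_pow_eq_monomial, map_one, one_mul, Polynomial.X_pow_comp] at h1
      rw [← Polynomial.C_mul_X_pow_eq_monomial, pow_succ', Polynomial.C_mul_comp,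
        Polynomial.mul_comp, Polynomial.X_pow_comp, Polynomial.X_comp]
      simp only [map_mul, Module.End.mul_apply, Polynomial.aeval_X, Polynomial.aeval_C,
        Module.algebraMap_end_apply, map_smul, map_sub, LinearMap.sub_apply, H.Dp_d, h1]
      module

/-- With `e t ≠ 0`, applying `D_t^+` to `q(d) w = 0` gives `q(d - |t|) w = 0`. The difference of the
two polynomials has smaller degree, so by induction `q` is invariant under translation by `|t|`,
hence constant, and `w ≠ 0` makes it zero. -/
theorem eq_zero_of_aeval (he : ∃ t, e t ≠ 0) (q : Polynomial ℂ)
    (h : Polynomial.aeval (ρ d) q w = 0) : q = 0 := by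
  obtain ⟨t, ht⟩ := he
  induction hn : q.natDegree using Nat.strong_induction_on generalizing q with
  | _ n ih =>
    have hsz : (t.size : ℂ) ≠ 0 := Nat.cast_ne_zero.2 t.size_pos.ne'
    set q' := q.comp (Polynomial.X - Polynomial.C (t.size : ℂ)) with hq'
    have h1 : Polynomial.aeval (ρ d) q' w = 0 := by
      have h2 := H.Dp_aeval t q w
      rw [h, map_zero, H.whittaker, map_smul] at h2
      exact (smul_eq_zero.1 h2.symm).resolve_left ht
    have hconst : ∀ a, q = Polynomial.C a → q = 0 := by
      rintro a rfl
      rw [Polynomial.aeval_C, Module.algebraMap_end_apply] at h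
      rw [(smul_eq_zero.1 h).resolve_right H.ne_zero, map_zero]
    by_cases hd : q.natDegree = 0
    · exact hconst _ (Polynomial.eq_C_of_natDegree_eq_zero hd)
    · have hq0 : q ≠ 0 := by rintro rfl; simp at hd
      have hnat : q'.natDegree = q.natDegree := by
        rw [hq', Polynomial.natDegree_comp, Polynomial.natDegree_X_sub_C, mul_one]
      have hlead : q'.leadingCoeff = q.leadingCoeff := by
        rw [hq', Polynomial.leadingCoeff_comp (by rw [Polynomial.natDegree_X_sub_C]; exact one_ne_zero),
          (Polynomial.monic_X_sub_C _).leadingCoeff, one_pow, mul_one]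
      have hq'0 : q' ≠ 0 := by
        rw [← Polynomial.leadingCoeff_ne_zero, hlead]; exact Polynomial.leadingCoeff_ne_zero.2 hq0
      have hlt : (q' - q).natDegree < q.natDegree := by
        rw [← hnat]
        by_cases hz : q' - q = 0
        · rw [hz, Polynomial.natDegree_zero, hnat]; exact Nat.pos_of_ne_zero hd
        · exact Polynomial.natDegree_lt_natDegree hz (Polynomial.degree_sub_lt_left
            (by
              rw [Polynomial.degree_eq_natDegree hq'0, Polynomial.degree_eq_natDegree hq0, hnat]) hq'0 hlead)
      have := ih _ (hn ▸ hlt) (q' - q) (by rw [map_sub, LinearMap.sub_apply, h1, h, sub_zero]) rfl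
      obtain ⟨a, ha⟩ := eq_C_of_comp_sub_eq hsz (sub_eq_zero.1 this)
      exact hconst a ha

/-- For `s` this large the commutator with `D_t^-` leaves only `α` terms, whose trees `r` satisfy
`|r| = |s| - |t|` and remain too large for the shorter word. -/
theorem Dp_word_eq_zero {R : ℕ} {u : V} (hu : ∀ r : RTree, R < r.size → ρ (Dp r) u = 0)
    (l : List RTree) {s : RTree} (hs : (l.map size).sum + R < s.size) :
    ρ (Dp s) (word ρ u (l.map some)) = 0 := by
  induction l generalizing s with
  | nil => exact hu s (by simpa using hs)
  | cons t l ih =>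
    rw [List.map_cons, List.sum_cons] at hs
    rw [List.map_cons, word, lowering, H.Dp_Dm, ih (by omega), map_zero, finsum_beta_eq_zero (by omega),
      if_neg (by rintro rfl; omega), finsum_eq_zero_of_forall_eq_zero]
    · simp
    · intro r
      by_cases hr : alpha t s r = 0
      · rw [hr, Nat.cast_zero, zero_smul]
      · have := size_of_alpha_ne_zero hr
        rw [ih (by omega), smul_zero]

/-- In `D_s^+ D_t^- = D_t^- D_s^+ - ...` the first term vanishes because `s` is too large for the
remaining word, and so do the `β` terms and `d`. The sum `-∑ α(t, s, r) D_r^+` is exactly one step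
of `trim`. -/
theorem Dp_word {R : ℕ} {g : Multiset RTree → ℂ} (hg : ∀ c, g c ≠ 0 → 1 + weight c = R) (hR : 0 < R)
    {u u' : V} (hu : ∀ r : RTree, R ≤ r.size → ρ (Dp r) u = g r.components • u')
    (l : List RTree) {s : RTree} (hs : (l.map size).sum + R ≤ s.size) :
    ρ (Dp s) (word ρ u (l.map some)) = trim g l (mon s.components) • u' := by
  induction l generalizing s with
  | nil => rw [trim_nil_mon]; exact hu s (by simpa using hs)
  | cons t l ih =>
    rw [List.map_cons, List.sum_cons] at hs
    have ht := t.size_pos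
    have hu0 : ∀ r : RTree, R < r.size → ρ (Dp r) u = 0 := by
      intro r hr
      rw [hu r hr.le]
      by_cases h : g r.components = 0
      · rw [h, zero_smul]
      · have := hg _ h
        rw [size_eq, ← weight] at hr
        omega
    rw [List.map_cons, word, lowering, H.Dp_Dm, H.Dp_word_eq_zero hu0 l (by omega), map_zero,
      finsum_beta_eq_zero (by omega), if_neg (by rintro rfl; omega), zero_sub, add_zero, add_zero,
      trim_cons, neg_smul, tot_Dm_mon_components]
    have h := map_finsum_smul (LinearMap.toSpanSingleton ℂ V u' ∘ₗ trim g l) (finite_alpha t s)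
      fun r => mon r.components
    simp only [LinearMap.comp_apply, LinearMap.toSpanSingleton_apply] at h
    rw [h]
    congr 1
    refine finsum_congr fun r => ?_
    by_cases hr : alpha t s r = 0
    · rw [hr, Nat.cast_zero, zero_smul, zero_smul]
    · have := size_of_alpha_ne_zero hr
      rw [ih (by omega)]

theorem mem_span_normal (v : V) : v ∈ Submodule.span ℂ (Set.range fun x : Multiset RTree × ℕ =>
    word ρ w (normalList x.1 x.2)) := by
  have hhom : ∀ j p, homogenize ρ w j p ∈ Submodule.span ℂ
      (Set.range fun x : Multiset RTree × ℕ => word ρ w (normalList x.1 x.2)) := by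
    intro j p
    have h : homogenize ρ w j p ∈ LinearMap.range (homogenize ρ w j) := ⟨p, rfl⟩
    rw [homogenize, Module.Basis.constr_range] at h
    refine Submodule.span_mono ?_ h
    rintro _ ⟨m, rfl⟩
    exact ⟨(_, _), rfl⟩
  obtain ⟨k, hk⟩ := H.exists_mem_wordSpan v
  induction k generalizing v with
  | zero =>
    rw [wordSpan_zero, Submodule.mem_bot] at hk
    rw [hk]; exact zero_mem _
  | succ j ih =>
    obtain ⟨p, _, hp⟩ := H.exists_homogenize hk
    have := add_mem (ih _ hp) (hhom j p)
    rwa [sub_add_cancel] at this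

/-- Being killed by `D_t^+ - e t` means that `q(d - |t|) - q(d)` annihilates `w`; hence `q` is
translation invariant. -/
theorem eq_smul_of_aeval {t : RTree} (ht : e t ≠ 0) {q : Polynomial ℂ}
    (hq : shifted ρ e t (Polynomial.aeval (ρ d) q w) = 0) :
    ∃ a : ℂ, Polynomial.aeval (ρ d) q w = a • w := by
  rw [shifted_apply, H.Dp_aeval, H.whittaker, map_smul, ← smul_sub, ← LinearMap.sub_apply,
    ← map_sub] at hq
  have h := H.eq_zero_of_aeval ⟨t, ht⟩ _ ((smul_eq_zero.1 hq).resolve_left ht)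
  obtain ⟨a, rfl⟩ := eq_C_of_comp_sub_eq (Nat.cast_ne_zero.2 t.size_pos.ne') (sub_eq_zero.1 h)
  exact ⟨a, by rw [Polynomial.aeval_C, Module.algebraMap_end_apply]⟩

/-- Whittaker vectors are unique up to scalars if `e` has bounded support. -/
theorem eq_smul_of_bounded {R : ℕ} (hR : ∀ s : RTree, R < s.size → e s = 0)
    (he : ∃ t : RTree, t.size = R ∧ e t ≠ 0) {v : V} (hv : ∀ s, shifted ρ e s v = 0) :
    ∃ a : ℂ, v = a • w := by
  obtain ⟨t₀, ht₀, het₀⟩ := he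
  obtain ⟨a, ha⟩ := Finsupp.mem_span_range_iff_exists_finsupp.1 (H.mem_span_normal v)
  obtain ⟨N, hN⟩ : ∃ N, ∀ x ∈ a.support, weight x.1 ≤ N :=
    ⟨a.support.sup fun x => weight x.1, fun x hx => Finset.le_sup (f := fun x => weight x.1) hx⟩
  -- Induction on a bound for the total size of the trees `D_t^-` in the expansion. At zero only
  -- powers of `d` are left.
  induction N with
  | zero =>
    have hva : v = Polynomial.aeval (ρ d) (∑ x ∈ a.support, Polynomial.monomial x.2 (a x)) w := by
      rw [← ha, Finsupp.sum, _root_.map_sum, LinearMap.sum_apply]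
      refine Finset.sum_congr rfl fun x hx => ?_
      have h0 : x.1 = 0 := Multiset.card_eq_zero.1
        (Nat.le_zero.1 ((card_le_weight x.1).trans (hN x hx)))
      rw [word_normalList, h0, Polynomial.aeval_monomial, Module.End.mul_apply,
        Module.algebraMap_end_apply]
      simp [word]
    rw [hva] at hv ⊢
    exact H.eq_smul_of_aeval het₀ (hv t₀)
  | succ N ih =>
    refine ih fun x₀ hx₀ => ?_
    by_contra hlt
    have hx₀N : weight x₀.1 = N + 1 := le_antisymm (hN x₀ hx₀) (by omega)
    set g : Multiset RTree → ℂ := fun c => if 1 + weight c = R then e (node c) else 0 with hgdef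
    have hg : ∀ c, g c ≠ 0 → 1 + weight c = R := fun c hc => by
      by_contra h
      exact hc (if_neg h)
    have hg0 : ∃ c, g c ≠ 0 := by
      refine ⟨t₀.components, ?_⟩
      rw [hgdef]
      beta_reduce
      rw [if_pos (by rw [← ht₀, size_eq, weight]), node_components]
      exact het₀
    set S₂ := a.support.filter fun x => weight x.1 = N + 1 with hS₂
    -- The forests in the top layer occurring with the same power of `d` as `x₀`.
    set S := (S₂.filter fun x => x.2 = x₀.2).image Prod.fst with hS
    have hSmem : ∀ c, c ∈ S ↔ (c, x₀.2) ∈ S₂ := by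
      intro c
      rw [hS, Finset.mem_image]
      constructor
      · rintro ⟨⟨c', p⟩, hx, rfl⟩
        obtain ⟨hx, rfl⟩ := Finset.mem_filter.1 hx
        exact hx
      · exact fun h => ⟨_, Finset.mem_filter.2 ⟨h, rfl⟩, rfl⟩
    obtain ⟨b, hb, hne⟩ := exists_sum_trim_ne_zero (N := N + 1) hg hg0 S
      (fun c hc => (Finset.mem_filter.1 ((hSmem c).1 hc)).2) (fun c => a (c, x₀.2))
      ⟨x₀.1, (hSmem _).2 (Finset.mem_filter.2 ⟨hx₀, hx₀N⟩), Finsupp.mem_support_iff.1 hx₀⟩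
    refine hne ?_
    set θ : Polynomial ℂ := Polynomial.X - Polynomial.C (R : ℂ) with hθ
    have hsize : (node b).size = N + 1 + R := by rw [size_node, ← weight, hb]
    have hu : ∀ (p : ℕ) (r : RTree), R ≤ r.size → ρ (Dp r) ((ρ d ^ p) w) =
        g r.components • Polynomial.aeval (ρ d) (θ ^ p) w := by
      intro p r hr
      have h := H.Dp_aeval r (Polynomial.X ^ p) w
      rw [map_pow, Polynomial.aeval_X, Polynomial.X_pow_comp, H.whittaker, map_smul] at h
      rw [h, hgdef]
      beta_reduce
      rw [node_components, weight, ← size_eq]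
      split_ifs with hrR
      · rw [hθ, hrR]
      · rw [hR r (by omega), zero_smul, zero_smul]
    -- The tree `node b` has size `N + 1 + R`, which is large enough to kill all words outside the
    -- top layer and to be exactly critical on it.
    have hword : ∀ x ∈ a.support, ρ (Dp (node b)) (word ρ w (normalList x.1 x.2)) =
        if weight x.1 = N + 1 then
          trim g x.1.toList (mon b) • Polynomial.aeval (ρ d) (θ ^ x.2) w else 0 := by
      intro x hx
      have hwt : (x.1.toList.map size).sum = weight x.1 := by
        rw [weight, ← Multiset.sum_coe, ← Multiset.map_coe, Multiset.coe_toList]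
      have hxN := hN x hx
      rw [word_normalList]
      split_ifs with h
      · rw [H.Dp_word hg (ht₀ ▸ t₀.size_pos) (hu x.2) _ (by omega), components_node]
      · refine H.Dp_word_eq_zero (R := R) (fun r hr => ?_) _ (by omega)
        rw [hu x.2 r hr.le, hgdef]
        beta_reduce
        rw [weight, ← size_eq, if_neg (by omega), zero_smul]
    have hzero : ∑ x ∈ S₂, (a x * trim g x.1.toList (mon b)) •
        Polynomial.aeval (ρ d) (θ ^ x.2) w = 0 := by
      have h := hv (node b)
      rw [shifted_apply, hR _ (by omega), zero_smul, sub_zero, ← ha, Finsupp.sum,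
        _root_.map_sum] at h
      rw [hS₂, Finset.sum_filter]
      refine Eq.trans ?_ h
      refine Finset.sum_congr rfl fun x hx => ?_
      rw [map_smul, hword x hx]
      split_ifs
      · rw [smul_smul]
      · rw [smul_zero]
    -- Since `e` vanishes at `node b`, the top layer yields `P(d - R) w = 0`. The vectors `d^p w`
    -- are independent, so `P = 0`; its coefficient at the exponent of `x₀` is the sum that was
    -- chosen nonzero.
    set P : Polynomial ℂ := ∑ x ∈ S₂, Polynomial.monomial x.2 (a x * trim g x.1.toList (mon b))
      with hP
    have hPθ : P.comp θ = 0 := by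
      refine H.eq_zero_of_aeval ⟨t₀, het₀⟩ _ ?_
      rw [hP, Polynomial.sum_comp, _root_.map_sum, LinearMap.sum_apply, ← hzero]
      refine Finset.sum_congr rfl fun x _ => ?_
      rw [Polynomial.monomial_comp, map_mul, Polynomial.aeval_C, Module.End.mul_apply,
        Module.algebraMap_end_apply]
    have hP0 : P = 0 := by
      have h := congrArg (fun q => q.comp (Polynomial.X + Polynomial.C (R : ℂ))) hPθ
      simpa [Polynomial.comp_assoc, hθ] using h
    have hcoeff := congrArg (fun q => q.coeff x₀.2) hP0
    simp only [hP, Polynomial.finsetSum_coeff, Polynomial.coeff_monomial, Polynomial.coeff_zero]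
      at hcoeff
    rw [← Finset.sum_filter] at hcoeff
    rw [hS, Finset.sum_image, ← hcoeff]
    · refine Finset.sum_congr rfl fun x hx => ?_
      rw [← (Finset.mem_filter.1 hx).2]
    · intro x hx y hy hxy
      exact Prod.ext hxy ((Finset.mem_filter.1 hx).2.trans (Finset.mem_filter.1 hy).2.symm)

theorem eq_smul_of_whittaker (he : ∃ t, e t ≠ 0) {v : V} (hv : ∀ t, ρ (Dp t) v = e t • v) :
    ∃ a : ℂ, v = a • w := by
  have hv' : ∀ s, shifted ρ e s v = 0 := fun s => by rw [shifted_apply, hv, sub_self]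
  -- In the bounded case, `R` is the largest size of a tree on which `e` is nonzero.
  by_cases h : ∀ n, ∃ s : RTree, n < s.size ∧ e s ≠ 0
  · exact H.eq_smul_of_unbounded h hv'
  · push Not at h
    obtain ⟨n, hn⟩ := h
    classical
    obtain ⟨t, ht⟩ := he
    have htn : t.size ≤ n := by
      by_contra h
      exact ht (hn t (by omega))
    set P : ℕ → Prop := fun k => ∃ r : RTree, r.size = k ∧ e r ≠ 0
    refine H.eq_smul_of_bounded (R := Nat.findGreatest P n) (fun s hs => ?_)
      (Nat.findGreatest_spec (P := P) htn ⟨t, rfl, ht⟩) hv'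
    by_contra hes
    have hsn : s.size ≤ n := by
      by_contra h
      exact hes (hn s (by omega))
    exact Nat.findGreatest_is_greatest hs hsn ⟨s, rfl, hes⟩

theorem eq_top_of_ne_bot (he : ∃ t, e t ≠ 0) {N : Submodule ℂ V}
    (hN : ∀ x, ∀ v ∈ N, ρ x v ∈ N) (h0 : N ≠ ⊥) : N = ⊤ := by
  obtain ⟨v, hvN, hv0, hv⟩ := H.exists_whittaker hN h0
  obtain ⟨a, rfl⟩ := H.eq_smul_of_whittaker he hv
  have ha : a ≠ 0 := by
    rintro rfl
    exact hv0 (zero_smul _ _)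
  exact H.cyclic N ((Submodule.smul_mem_iff _ ha).1 hvN) hN

end IsCyclicWhittaker

end Words

/-! ### Whittaker vectors and simplicity of the standard module -/

section Module

variable (η : LieAlgebra.LieCharacter ℂ nPlus)

/-- The action of `𝔤` on the standard Whittaker module. -/
noncomputable def standardAction : InsElimAlgebra →ₗ[ℂ] Module.End ℂ (StandardWhittaker η) where
  toFun x := Algebra.lsmul ℂ ℂ (StandardWhittaker η) (UniversalEnvelopingAlgebra.ι ℂ x)
  map_add' x y := by rw [map_add, map_add]
  map_smul' c x := by rw [map_smul, map_smul]; rfl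

theorem standardAction_apply (x : InsElimAlgebra) (v : StandardWhittaker η) :
    standardAction η x v = UniversalEnvelopingAlgebra.ι ℂ x • v := rfl

theorem smul_mem_of_standardAction_mem {N : Submodule ℂ (StandardWhittaker η)}
    (hN : ∀ x, ∀ v ∈ N, standardAction η x v ∈ N) (a : Ug) {v : StandardWhittaker η} (hv : v ∈ N) :
    a • v ∈ N := by
  induction a using UEA_induction generalizing v with
  | hι x => exact hN x v hv
  | hc c => rw [algebraMap_smul]; exact N.smul_mem c hv
  | ha a b ha hb => rw [add_smul]; exact add_mem (ha hv) (hb hv)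
  | hm a b ha hb => rw [mul_smul]; exact ha (hb hv)

theorem isCyclicWhittaker_cyclicVector : IsCyclicWhittaker (standardAction η)
    (fun t => η (nPlus.Dp t)) (cyclicVector η) where
  lie x y v := by
    simp only [standardAction_apply]
    rw [LieHom.map_lie, LieRing.of_associative_ring_bracket, sub_smul, mul_smul, mul_smul]
  whittaker t := ι_smul_cyclicVector η (nPlus.Dp t)
  ne_zero := cyclicVector_ne_zero η
  cyclic N hw hN := by
    refine Submodule.eq_top_iff'.2 fun v => ?_
    obtain ⟨a, rfl⟩ := cyclicVector_generates η v
    exact smul_mem_of_standardAction_mem η hN a hw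

variable {η}

theorem exists_apply_Dp_ne_zero (hη : η ≠ 0) : ∃ t, η (nPlus.Dp t) ≠ 0 := by
  by_contra! h
  refine hη (LieHom.ext fun x => ?_)
  induction x using nPlus_induction with
  | hb t => exact h t
  | h0 => simp
  | ha x y hx hy => rw [map_add, hx, hy, map_add]
  | hs c x hx => rw [map_smul, hx, map_smul]

theorem whittakerVectors_eq_span (hη : η ≠ 0) :
    whittakerVectors η (StandardWhittaker η) = Submodule.span ℂ {cyclicVector η} := by
  refine le_antisymm (fun v hv => ?_) ?_
  · obtain ⟨a, rfl⟩ := (isCyclicWhittaker_cyclicVector η).eq_smul_of_whittaker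
      (exists_apply_Dp_ne_zero hη) (v := v) fun t => hv (nPlus.Dp t)
    exact Submodule.smul_mem _ a (Submodule.mem_span_singleton_self _)
  · rw [Submodule.span_singleton_le_iff_mem]
    exact ι_smul_cyclicVector η

theorem isSimpleModule_standardWhittaker (hη : η ≠ 0) :
    IsSimpleModule Ug (StandardWhittaker η) := by
  have : Nontrivial (StandardWhittaker η) := ⟨⟨_, 0, cyclicVector_ne_zero η⟩⟩
  refine { toIsSimpleOrder := { eq_bot_or_eq_top := fun N => ?_ } }
  rw [or_iff_not_imp_left]
  intro h0
  have h := (isCyclicWhittaker_cyclicVector η).eq_top_of_ne_bot (exists_apply_Dp_ne_zero hη)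
    (N := N.restrictScalars ℂ) (fun x v hv => N.smul_mem _ hv)
    (fun h => h0 ((Submodule.restrictScalars_eq_bot_iff _ _ _).1 h))
  exact (Submodule.restrictScalars_eq_top_iff _ _ _).1 h

end Module

end InsertionElimination

theorem mainTheorem2
    (η : LieAlgebra.LieCharacter ℂ InsertionElimination.InsElimAlgebra.nPlus)
    (hη : η ≠ 0) (hbd : InsertionElimination.DepthBounded η) :
    Module.finrank ℂ (InsertionElimination.whittakerVectors η
      (InsertionElimination.StandardWhittaker η)) = 1 ∧
    IsSimpleModule InsertionElimination.Ug (InsertionElimination.StandardWhittaker η) := by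
  refine ⟨?_, InsertionElimination.isSimpleModule_standardWhittaker hη⟩
  rw [InsertionElimination.whittakerVectors_eq_span hη]
  exact finrank_span_singleton (InsertionElimination.cyclicVector_ne_zero η)
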